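/- **Theorem 3.1 (Flat flows).** Let $d\ge 2$, let $\mathbb T^{d-1}=\mathbb R^{d-1}/\mathbb Z^{d-1}$ be the flat torus, and let $\mathfrak M$ be the class of Lebesgue measurable subsets of $\mathbb T^{d-1}\times\mathbb R$. For $R>0$ put $\mathbb S_R^d=\mathbb T^{d-1}\times(-R,R)$ and $$\mathfrak M_R=\{E\in\mathfrak M:\ \mathbb T^{d-1}\times(-\infty,-R)\subseteq E\subseteq\mathbb T^{d-1}\times(-\infty,R)\}.$$ For $L>0$ let $\mathfrak C_L$ be the class of periodic $L$-Lipschitz subgraphs, i.e. of the sets $\{(x',x_d): x_d\le g(x')\}$ with $g:\mathbb T^{d-1}\to\mathbb R$ $L$-Lipschitz. A *generalized perimeter* is a functional $\mathscr P:\mathfrak M\to[0,+\infty]$ such that: (i) $\mathscr P(E)<+\infty$ for every $L>0$ and $E\in\mathfrak C_L$; (ii) $\mathscr P(\emptyset)=\mathscr P(\mathbb T^{d-1}\times\mathbb R)=0$; (iii) $\mathscr P(E)=\mathscr P(E')$ if $|E\triangle E'|=0$; (iv) if $|(E_n\triangle E)\cap\mathbb S^d_R|\to0$ for every $R>0$,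 then $\mathscr P(E)\le\liminf_n\mathscr P(E_n)$; (v) $\mathscr P(E\cup F)+\mathscr P(E\cap F)\le\mathscr P(E)+\mathscr P(F)$; (vi) $\mathscr P(E+\tau)=\mathscr P(E)$ for every $\tau\in\mathbb R^d$. Sets in $\mathfrak M_R$ are identified with their Lebesgue representative (the set of points of density one), and $\mathrm{sdist}_E(x)=\mathrm{dist}(x,E)-\mathrm{dist}(x,E^c)$. For $h>0$ and $E\in\mathfrak M_R\cap\mathfrak C_L$, the set $T_h[E]$ is the common value of the smallest and the largest (with respect to inclusion) minimizer of $$F\mapsto \mathscr P(F)+\frac1h\int_{F\cap\mathbb S_R^d}\mathrm{sdist}_E(x)\,dx\qquad\text{over } F\in\mathfrak M_R ,$$ which exists. For $E_0\in\mathfrak M_R\cap\mathfrak C_L$ the approximate flat solution with time step $h$ is $$E^{(h)}_t[E_0]=(T_h)^{k}[E_0]\quad\text{for } t\in[kh,(k+1)h),\ k=0,1,2,\dots$$ Given a sequence $h_k\to0$ of positive numbers, a family $\{E_t\}_{t\ge0}\subset\mathfrak C_L$ with $E_0$ the given initial set and $|E^{(h_k)}_t[E_0]\triangle E_t|\to0$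 as $k\to\infty$ for every $t\ge0$ is unique if it exists; it is then called the flat flow with initial datum $E_0$ along $\{h_k\}$ and denoted by $E^0_t[E_0,\{h_k\}]$. Let $\mathscr P$ be a generalized perimeter, let $L>0$ and let $E_0\in\mathfrak C_L$ with $\mathscr P(E_0)<+\infty$. Then there is a constant $C$, depending only on $d$, $L$, $\mathscr P$ and $E_0$, such that for every $R>0$ with $E_0\in\mathfrak M_R$ and every monotonically vanishing sequence $\{h_n\}\subset(0,+\infty)$ there is a subsequence $\{h_k\}:=\{h_{n_k}\}$ with the following properties. 1. The flat flow $E^0_t:=E^0_t[E_0,\{h_k\}]$ exists: $E^0_t\in\mathfrak C_L$ for every $t\ge0$, $E^0_0=E_0$, and $|E^{(h_k)}_t[E_0]\triangle E^0_t|\to0$ for every $t\ge0$. 2. $|E^0_t\triangle E^0_s|\le C|t-s|^{1/2}$ for all $t,s\ge0$. 3. (Semigroup property) For every $\bar t\ge0$ the flat flow with initial datum $E^0_{\bar t}$ along the same sequence $\{h_k\}$ exists, and $$E^0_{\Delta t}\big[E^0_{\bar t}[E_0,\{h_k\}],\{h_k\}\big]=E^0_{\bar t+\Delta t}[E_0,\{h_k\}]\qquad\text{for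 all }\bar t,\Delta t\ge0 .$$ 4. $\mathscr P(E^0_{t'})\le\mathscr P(E^0_t)$ whenever $0\le t\le t'$. -/

import Mathlib

open MeasureTheory Filter Topology
open scoped ENNReal symmDiff

namespace FlatFlow

/-- The flat torus `ℝ^{d-1} / ℤ^{d-1}`, as a group with its Haar (= Lebesgue) probability measure.
Its Euclidean distance is `torusDist` below (the instance distance on this `Pi` type, the
sup distance, is never used). -/
abbrev Torus (d : ℕ) : Type := Fin (d - 1) → UnitAddCircle

/-- The cylinder `𝕋^{d-1} × ℝ`; `volume` is the Lebesgue measure, and the group structure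
gives the translations (every vector of `ℝ^d` acts through its class modulo `ℤ^{d-1} × {0}`). -/
abbrev Cyl (d : ℕ) : Type := Torus d × ℝ

/-- The flat (Euclidean) distance on the torus. -/
noncomputable def torusDist {d : ℕ} (x y : Torus d) : ℝ :=
  dist (WithLp.toLp 2 x : PiLp 2 fun _ : Fin (d - 1) => UnitAddCircle) (WithLp.toLp 2 y)

/-- The same points, in the type that carries the Euclidean (flat) distance on `𝕋^{d-1} × ℝ`. -/
noncomputable def eucl {d : ℕ} (x : Cyl d) :
    WithLp 2 ((PiLp 2 fun _ : Fin (d - 1) => UnitAddCircle) × ℝ) :=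
  WithLp.toLp 2 (WithLp.toLp 2 x.1, x.2)

/-- Euclidean distance of a point of the cylinder from a set. -/
noncomputable def distTo {d : ℕ} (x : Cyl d) (A : Set (Cyl d)) : ℝ :=
  Metric.infDist (eucl x) (eucl '' A)

/-- Euclidean open ball in the cylinder. -/
def cylBall {d : ℕ} (x : Cyl d) (r : ℝ) : Set (Cyl d) :=
  {y | dist (eucl y) (eucl x) < r}

/-- The strip `𝕋^{d-1} × (-R, R)`. -/
def strip (d : ℕ) (R : ℝ) : Set (Cyl d) := {x | x.2 ∈ Set.Ioo (-R) R}

/-- `E` is a periodic `L`-Lipschitz subgraph: `E = {(x', x_d) : x_d ≤ g x'}` with `g`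
`L`-Lipschitz on the flat torus. -/
def IsLipSubgraph {d : ℕ} (L : ℝ) (E : Set (Cyl d)) : Prop :=
  ∃ g : Torus d → ℝ, (∀ x y, |g x - g y| ≤ L * torusDist x y) ∧ E = {x | x.2 ≤ g x.1}

/-- Generalized perimeters. Lebesgue measurable sets are the sets with
`NullMeasurableSet E volume`; the values of `P` on other sets are irrelevant. -/
structure IsGeneralizedPerimeter {d : ℕ} (P : Set (Cyl d) → ℝ≥0∞) : Prop where
  finite_of_lip : ∀ (L : ℝ), 0 < L → ∀ E : Set (Cyl d), IsLipSubgraph L E → P E < ∞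
  empty : P ∅ = 0
  univ : P Set.univ = 0
  congr_null : ∀ E E' : Set (Cyl d), NullMeasurableSet E volume → NullMeasurableSet E' volume →
    volume (E ∆ E') = 0 → P E = P E'
  lsc : ∀ (E : Set (Cyl d)) (En : ℕ → Set (Cyl d)), NullMeasurableSet E volume →
    (∀ n, NullMeasurableSet (En n) volume) →
    (∀ R : ℝ, 0 < R → Tendsto (fun n => volume ((En n ∆ E) ∩ strip d R)) atTop (𝓝 0)) →
    P E ≤ liminf (fun n => P (En n)) atTop
  submodular : ∀ E F : Set (Cyl d), NullMeasurableSet E volume → NullMeasurableSet F volume →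
    P (E ∪ F) + P (E ∩ F) ≤ P E + P F
  translate : ∀ (E : Set (Cyl d)) (τ : Cyl d), NullMeasurableSet E volume →
    P ((fun x => x + τ) '' E) = P E

/-- The class `𝔐_R` of measurable sets between `𝕋^{d-1} × (-∞, -R)` and `𝕋^{d-1} × (-∞, R)`. -/
def IsBetween {d : ℕ} (R : ℝ) (E : Set (Cyl d)) : Prop :=
  NullMeasurableSet E volume ∧ {x : Cyl d | x.2 < -R} ⊆ E ∧ E ⊆ {x : Cyl d | x.2 < R}

/-- The Lebesgue representative of `E`: the set of points of density one for `E`. -/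
def lebRep {d : ℕ} (E : Set (Cyl d)) : Set (Cyl d) :=
  {x | Tendsto (fun r : ℝ => volume (E ∩ cylBall x r) / volume (cylBall x r)) (𝓝[>] 0) (𝓝 1)}

/-- Signed distance from (the Lebesgue representative of) `E`, negative inside. -/
noncomputable def sdist {d : ℕ} (E : Set (Cyl d)) (x : Cyl d) : ℝ :=
  distTo x (lebRep E) - distTo x (lebRep E)ᶜ

/-- The incremental functional `P(F) + (1/h) ∫_{F ∩ (𝕋^{d-1} × (-R,R))} sdist_E dx`,
with values in `(-∞, +∞]`. -/
noncomputable def stepEnergy {d : ℕ} (P : Set (Cyl d) → ℝ≥0∞) (R h : ℝ) (E F : Set (Cyl d)) :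
    EReal :=
  ((P F : ℝ≥0∞) : EReal) + (((1 / h) * ∫ x in F ∩ strip d R, sdist E x : ℝ) : EReal)

/-- `F` is a minimizer of the incremental problem in `𝔐_R`; minimizers, like all the sets of
`𝔐_R`, are represented by their Lebesgue representative. -/
def IsStepMinimizer {d : ℕ} (P : Set (Cyl d) → ℝ≥0∞) (R h : ℝ) (E F : Set (Cyl d)) : Prop :=
  IsBetween R F ∧ lebRep F = F ∧
    ∀ G : Set (Cyl d), IsBetween R G → stepEnergy P R h E F ≤ stepEnergy P R h E G

/-- Smallest minimizer with respect to inclusion, `T_h^-[E]`. -/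
def IsMinimalStep {d : ℕ} (P : Set (Cyl d) → ℝ≥0∞) (R h : ℝ) (E F : Set (Cyl d)) : Prop :=
  IsStepMinimizer P R h E F ∧ ∀ G, IsStepMinimizer P R h E G → F ⊆ G

/-- Largest minimizer with respect to inclusion, `T_h^+[E]`. -/
def IsMaximalStep {d : ℕ} (P : Set (Cyl d) → ℝ≥0∞) (R h : ℝ) (E F : Set (Cyl d)) : Prop :=
  IsStepMinimizer P R h E F ∧ ∀ G, IsStepMinimizer P R h E G → G ⊆ F

/-- `T_h[E]`, the common value of `T_h^-[E]` and `T_h^+[E]` (an unspecified set if there is no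
such common value). -/
noncomputable def stepSet {d : ℕ} (P : Set (Cyl d) → ℝ≥0∞) (R h : ℝ) (E : Set (Cyl d)) :
    Set (Cyl d) :=
  Classical.epsilon fun F => IsMinimalStep P R h E F ∧ IsMaximalStep P R h E F

/-- The discrete evolution `E_{kh}`, `k ∈ ℕ`. -/
noncomputable def discreteFlow {d : ℕ} (P : Set (Cyl d) → ℝ≥0∞) (R h : ℝ) (E₀ : Set (Cyl d)) :
    ℕ → Set (Cyl d)
  | 0 => E₀
  | k + 1 => stepSet P R h (discreteFlow P R h E₀ k)

/-- The approximate flat solution with time step `h`: it is `E_{kh}` for `t ∈ [kh, (k+1)h)`. -/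
noncomputable def approxFlow {d : ℕ} (P : Set (Cyl d) → ℝ≥0∞) (R h : ℝ) (E₀ : Set (Cyl d))
    (t : ℝ) : Set (Cyl d) :=
  discreteFlow P R h E₀ ⌊t / h⌋₊

/-- `(E t)_{t ≥ 0}` is the flat flow of periodic `L`-Lipschitz subgraphs with initial datum `E₀`
along the sequence of time steps `h`: the limit in measure, at every time, of the approximate
flat solutions. -/
def IsFlatFlow {d : ℕ} (P : Set (Cyl d) → ℝ≥0∞) (R L : ℝ) (h : ℕ → ℝ) (E₀ : Set (Cyl d))
    (E : ℝ → Set (Cyl d)) : Prop :=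
  E 0 = E₀ ∧ ∀ t : ℝ, 0 ≤ t → IsLipSubgraph L (E t) ∧
    Tendsto (fun k => volume (approxFlow P R (h k) E₀ t ∆ E t)) atTop (𝓝 0)

end FlatFlow

/-! The proof rests on a comparison principle that uses only submodularity and translation
invariance of the perimeter. If `F₁` and `F₂` minimize for the weights `w₁` and `w₂`, test them with
`F₁ ∩ (F₂ + v)` and with `F₁ ∪ (F₂ + v)` moved back by `-v`. For `v` pointing upwards both
competitors are admissible, the perimeters cancel, and only the weights on `F₁ \ (F₂ + v)` remain;
this set is null once `w₂(· - v)` lies below `w₁` by a positive constant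
(`mul_volume_diff_shift_le`).

When the datum is an `L`-Lipschitz subgraph, taking `v` in the cone `s > L|τ|` shows that minimizers
are again `L`-Lipschitz subgraphs (`exists_under_of_cone`). Vertical `v` gives uniqueness,
monotonicity of the step and non-expansiveness in the sup norm (`le_add_of_isAlmostMin`). The
version with errors makes minimizing sequences Cauchy in measure; this yields existence although a
bound on the perimeter gives no compactness (`exists_isAlmostMin_zero`).

Testing minimality with the previous set bounds the square of the measure swept in one step by `h`
times the drop of perimeter (`sq_volume_symmDiff_le`). Telescoping and Cauchy–Schwarz give a
discrete 1/2-Hölder estimate. For equi-Lipschitz graphs closeness in measure is uniform closeness,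
so Arzelà–Ascoli and a diagonal argument give a subsequence converging uniformly on the torus at
every time.

By non-expansiveness, approximate flows restarted from the limit at time `r` stay uniformly close to
the original ones after time `r`; this is the semigroup property. Monotonicity of the perimeter
follows by lower semicontinuity along restarted flows. -/

namespace FlatFlow

variable {d : ℕ}

/-! ### The flat distance on the torus and the cylinder -/

theorem torusDist_eq (x y : Torus d) : torusDist x y = √(∑ i, ‖x i - y i‖ ^ 2) := by
  rw [torusDist, PiLp.dist_eq_of_L2]
  simp only [dist_eq_norm]

theorem dist_eucl (x y : Cyl d) :
    dist (eucl x) (eucl y) = √(∑ i, ‖x.1 i - y.1 i‖ ^ 2 + |x.2 - y.2| ^ 2) := by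
  rw [eucl, eucl, WithLp.prod_dist_eq_of_L2]
  have h : 0 ≤ ∑ i, ‖x.1 i - y.1 i‖ ^ 2 := Finset.sum_nonneg fun i _ => sq_nonneg _
  change √(torusDist x.1 y.1 ^ 2 + |x.2 - y.2| ^ 2) = _
  rw [torusDist_eq, Real.sq_sqrt h]

theorem torusDist_nonneg (x y : Torus d) : 0 ≤ torusDist x y := dist_nonneg

theorem torusDist_self (x : Torus d) : torusDist x x = 0 := dist_self _

theorem torusDist_comm (x y : Torus d) : torusDist x y = torusDist y x := dist_comm _ _

theorem torusDist_triangle (x y z : Torus d) :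
    torusDist x z ≤ torusDist x y + torusDist y z := dist_triangle _ _ _

theorem torusDist_sub_right (x y z : Torus d) : torusDist (x - z) (y - z) = torusDist x y := by
  simp [torusDist_eq]

theorem continuous_torusDist_left (x : Torus d) : Continuous fun y : Torus d => torusDist y x := by
  have h := PiLp.continuous_toLp 2 (fun _ : Fin (d - 1) => UnitAddCircle)
  exact h.dist continuous_const

theorem dist_eucl_eq (x y : Cyl d) :
    dist (eucl x) (eucl y) = √(torusDist x.1 y.1 ^ 2 + |x.2 - y.2| ^ 2) := by
  rw [dist_eucl, torusDist_eq, Real.sq_sqrt (Finset.sum_nonneg fun i _ => sq_nonneg _)]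

theorem torusDist_le_dist (x y : Cyl d) : torusDist x.1 y.1 ≤ dist (eucl x) (eucl y) := by
  rw [dist_eucl_eq]
  exact Real.le_sqrt_of_sq_le (by nlinarith [sq_nonneg |x.2 - y.2|])

theorem abs_sub_le_dist (x y : Cyl d) : |x.2 - y.2| ≤ dist (eucl x) (eucl y) := by
  rw [dist_eucl_eq]
  exact Real.le_sqrt_of_sq_le (by nlinarith [sq_nonneg (torusDist x.1 y.1)])

theorem dist_le_add (x y : Cyl d) :
    dist (eucl x) (eucl y) ≤ torusDist x.1 y.1 + |x.2 - y.2| := by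
  rw [dist_eucl_eq]
  have h1 := torusDist_nonneg x.1 y.1
  have h2 := abs_nonneg (x.2 - y.2)
  exact Real.sqrt_le_iff.2 ⟨by positivity, by nlinarith⟩

theorem dist_eucl_sub_right (x y v : Cyl d) :
    dist (eucl (x - v)) (eucl (y - v)) = dist (eucl x) (eucl y) := by
  simp [dist_eucl]

theorem continuous_eucl : Continuous (eucl : Cyl d → _) := by
  unfold eucl
  have h := PiLp.continuous_toLp 2 (fun _ : Fin (d - 1) => UnitAddCircle)
  exact (WithLp.prod_continuous_toLp 2 _ _).comp ((h.comp continuous_fst).prodMk continuous_snd)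

/-- The representative `r - round r` of `a - b` realizes the norm, so moving along a fraction `θ` of
it follows a shortest arc. -/
theorem exists_between_circle (a b : UnitAddCircle) {θ : ℝ} (h0 : 0 ≤ θ) (h1 : θ ≤ 1) :
    ∃ m, ‖a - m‖ ≤ θ * ‖a - b‖ ∧ ‖m - b‖ ≤ (1 - θ) * ‖a - b‖ := by
  obtain ⟨r, hr⟩ := QuotientAddGroup.mk_surjective (a - b)
  have hn : ‖a - b‖ = |r - round r| := by
    rw [← hr]; exact UnitAddCircle.norm_eq
  set r' : ℝ := r - round r with hr'
  have hab : ((r' : ℝ) : UnitAddCircle) = a - b := by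
    rw [← hr, hr', AddCircle.coe_sub]
    have : (((round r : ℤ) : ℝ) : UnitAddCircle) = 0 := by
      rw [AddCircle.coe_eq_zero_iff]; exact ⟨round r, by simp⟩
    rw [this, sub_zero]
  have hle : ∀ s : ℝ, ‖(s : UnitAddCircle)‖ ≤ |s| := fun s => by
    rw [UnitAddCircle.norm_eq]
    simpa using round_le s 0
  refine ⟨a - ((θ * r' : ℝ) : UnitAddCircle), ?_, ?_⟩
  · rw [sub_sub_cancel, hn]
    exact (hle _).trans_eq (by rw [abs_mul, abs_of_nonneg h0])
  · have : a - ((θ * r' : ℝ) : UnitAddCircle) - b = (((1 - θ) * r' : ℝ) : UnitAddCircle) := by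
      rw [sub_right_comm, ← hab, ← AddCircle.coe_sub]; ring_nf
    rw [this, hn]
    exact (hle _).trans_eq (by rw [abs_mul, abs_of_nonneg (sub_nonneg.2 h1)])

theorem dist_eucl_le_mul {x y p q : Cyl d} {θ : ℝ} (h0 : 0 ≤ θ)
    (h1 : ∀ i, ‖x.1 i - y.1 i‖ ≤ θ * ‖p.1 i - q.1 i‖) (h2 : |x.2 - y.2| ≤ θ * |p.2 - q.2|) :
    dist (eucl x) (eucl y) ≤ θ * dist (eucl p) (eucl q) := by
  rw [dist_eucl, dist_eucl]
  conv_rhs => rw [← Real.sqrt_sq h0, ← Real.sqrt_mul (sq_nonneg θ)]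
  apply Real.sqrt_le_sqrt
  rw [mul_add, Finset.mul_sum]
  gcongr with i
  · rw [← mul_pow]; exact pow_le_pow_left₀ (norm_nonneg _) (h1 i) 2
  · rw [← mul_pow]; exact pow_le_pow_left₀ (abs_nonneg _) h2 2

/-- The cylinder is a length space. -/
theorem exists_eucl_between (p q : Cyl d) {ρ : ℝ} (h0 : 0 ≤ ρ) (h1 : ρ ≤ dist (eucl p) (eucl q)) :
    ∃ m, dist (eucl p) (eucl m) ≤ dist (eucl p) (eucl q) - ρ ∧ dist (eucl m) (eucl q) ≤ ρ := by
  rcases (h0.trans h1).eq_or_lt with hD | hD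
  · exact ⟨p, by rw [dist_self]; linarith, by linarith⟩
  generalize hDe : dist (eucl p) (eucl q) = D at *
  have ht0 : 0 ≤ 1 - ρ / D := sub_nonneg.2 ((div_le_one hD).2 h1)
  have ht1 : 1 - ρ / D ≤ 1 := by have : 0 ≤ ρ / D := by positivity
                                 linarith
  choose m hm1 hm2 using fun i => exists_between_circle (p.1 i) (q.1 i) ht0 ht1
  refine ⟨(m, p.2 - (1 - ρ / D) * (p.2 - q.2)), ?_, ?_⟩
  · refine (dist_eucl_le_mul (x := p) (y := (m, p.2 - (1 - ρ / D) * (p.2 - q.2)))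
      (p := p) (q := q) ht0 hm1 ?_).trans_eq ?_
    · rw [sub_sub_cancel, abs_mul, abs_of_nonneg ht0]
    · rw [hDe]
      field_simp
  · refine (dist_eucl_le_mul (x := (m, p.2 - (1 - ρ / D) * (p.2 - q.2))) (y := q)
      (p := p) (q := q) (sub_nonneg.2 ht1) hm2 ?_).trans_eq ?_
    · have : p.2 - (1 - ρ / D) * (p.2 - q.2) - q.2 = (1 - (1 - ρ / D)) * (p.2 - q.2) := by ring
      rw [this, abs_mul, abs_of_nonneg (sub_nonneg.2 ht1)]
    · rw [hDe]
      field_simp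
      ring

/-! ### Lipschitz subgraphs and their signed distance -/

/-- `g` is `L`-Lipschitz for the flat distance of the torus. -/
def TorusLip (L : ℝ) (g : Torus d → ℝ) : Prop := ∀ x y, |g x - g y| ≤ L * torusDist x y

/-- The strict subgraph of `g`. -/
def under (g : Torus d → ℝ) : Set (Cyl d) := {x | x.2 < g x.1}

@[simp] theorem mem_under {g : Torus d → ℝ} {x : Cyl d} : x ∈ under g ↔ x.2 < g x.1 := Iff.rfl

theorem TorusLip.continuous {L : ℝ} {g : Torus d → ℝ} (hg : TorusLip L g) : Continuous g := by
  rw [continuous_iff_continuousAt]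
  intro x
  rw [ContinuousAt, tendsto_iff_dist_tendsto_zero]
  have h2 : Tendsto (fun y => L * torusDist y x) (𝓝 x) (𝓝 (L * torusDist x x)) :=
    ((continuous_torusDist_left x).const_smul L).tendsto x
  rw [torusDist_self, mul_zero] at h2
  exact squeeze_zero (fun _ => dist_nonneg) (fun y => hg y x) h2

theorem isOpen_under {g : Torus d → ℝ} (hg : Continuous g) : IsOpen (under g) :=
  isOpen_lt continuous_snd (hg.comp continuous_fst)

/-- The vertical gap to a Lipschitz graph is `(1 + L)`-Lipschitz. -/
theorem TorusLip.gap_le {L : ℝ} (hL : 0 ≤ L) {g : Torus d → ℝ} (hg : TorusLip L g) (x y : Cyl d) :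
    (x.2 - g x.1) - (y.2 - g y.1) ≤ (1 + L) * dist (eucl x) (eucl y) := by
  have h1 := (le_abs_self _).trans (abs_sub_le_dist x y)
  have h2 := (neg_abs_le _).trans' (neg_le_neg (hg x.1 y.1))
  have h3 := mul_le_mul_of_nonneg_left (torusDist_le_dist x y) hL
  linarith

/-- The signed distance from a set, without passing to the Lebesgue representative. -/
noncomputable def sd (A : Set (Cyl d)) (x : Cyl d) : ℝ := distTo x A - distTo x Aᶜ

theorem continuous_sd (A : Set (Cyl d)) : Continuous (sd A) := by
  unfold sd distTo
  exact ((Metric.continuous_infDist_pt _).comp continuous_eucl).sub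
    ((Metric.continuous_infDist_pt _).comp continuous_eucl)

theorem distTo_le {x a : Cyl d} {A : Set (Cyl d)} (ha : a ∈ A) :
    distTo x A ≤ dist (eucl x) (eucl a) :=
  Metric.infDist_le_dist_of_mem (Set.mem_image_of_mem _ ha)

theorem le_distTo {x : Cyl d} {A : Set (Cyl d)} {r : ℝ} (hA : A.Nonempty)
    (h : ∀ a ∈ A, r ≤ dist (eucl x) (eucl a)) : r ≤ distTo x A := by
  refine (Metric.le_infDist (hA.image _)).2 ?_
  rintro _ ⟨a, ha, rfl⟩
  exact h a ha

theorem distTo_eq_zero {x : Cyl d} {A : Set (Cyl d)} (hx : x ∈ A) : distTo x A = 0 :=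
  Metric.infDist_zero_of_mem (Set.mem_image_of_mem _ hx)

theorem distTo_nonneg (x : Cyl d) (A : Set (Cyl d)) : 0 ≤ distTo x A := Metric.infDist_nonneg

/-- Enlarging a set by a `ρ`-neighbourhood lowers the signed distance by at least `ρ`. -/
theorem sd_add_le {A B : Set (Cyl d)} {ρ : ℝ} (hρ : 0 ≤ ρ) (hA : A.Nonempty) (hB : Bᶜ.Nonempty)
    (h : ∀ a ∈ A, ∀ y, dist (eucl y) (eucl a) ≤ ρ → y ∈ B) (x : Cyl d) :
    sd B x + ρ ≤ sd A x := by
  have hAB : A ⊆ B := fun a ha => h a ha a (by simpa using hρ)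
  unfold sd
  by_cases hxA : x ∈ A
  · rw [distTo_eq_zero hxA, distTo_eq_zero (hAB hxA)]
    suffices distTo x Aᶜ + ρ ≤ distTo x Bᶜ by linarith
    refine le_distTo hB fun z hz => ?_
    have hxz : ρ ≤ dist (eucl x) (eucl z) := by
      by_contra hlt
      exact hz (h x hxA z (by rw [dist_comm]; exact (not_le.1 hlt).le))
    -- Stop at distance `ρ` from `z` on the way from `x`: as `z ∉ B`, the stopping point is outside
    -- `A`, so `Aᶜ` is closer to `x` than `Bᶜ` by `ρ`. The case `x ∉ B` below is the mirror image.
    obtain ⟨m, hm1, hm2⟩ := exists_eucl_between x z hρ hxz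
    have hm : m ∈ Aᶜ := fun hm => hz (h m hm z (by rwa [dist_comm]))
    linarith [distTo_le (x := x) hm]
  · by_cases hxB : x ∈ B
    · rw [distTo_eq_zero (A := Aᶜ) hxA, distTo_eq_zero hxB]
      have h1 : ρ - distTo x Bᶜ ≤ distTo x A := by
        refine le_distTo hA fun a ha => ?_
        have h2 : ρ - dist (eucl x) (eucl a) ≤ distTo x Bᶜ := by
          refine le_distTo hB fun z hz => ?_
          by_contra hlt
          refine hz (h a ha z ?_)
          have := dist_triangle (eucl z) (eucl x) (eucl a)
          rw [dist_comm (eucl z) (eucl x)] at this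
          linarith
        linarith
      linarith
    · rw [distTo_eq_zero (A := Aᶜ) hxA, distTo_eq_zero (A := Bᶜ) hxB]
      suffices distTo x B + ρ ≤ distTo x A by linarith
      refine le_distTo hA fun a ha => ?_
      have hxa : ρ ≤ dist (eucl x) (eucl a) := by
        by_contra hlt
        exact hxB (h a ha x (not_le.1 hlt).le)
      obtain ⟨m, hm1, hm2⟩ := exists_eucl_between x a hρ hxa
      linarith [distTo_le (x := x) (h a ha m hm2)]

theorem under_nonempty (g : Torus d → ℝ) : (under g).Nonempty := ⟨(0, g 0 - 1), by simp⟩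

theorem under_compl_nonempty (g : Torus d → ℝ) : (under g)ᶜ.Nonempty := ⟨(0, g 0), by simp⟩

/-- The vertical gap is `(1 + L)`-Lipschitz, so a vertical room `δ` contains a neighbourhood of
Euclidean width `δ / (1 + L)`. -/
theorem sd_under_add_le {L δ : ℝ} (hL : 0 ≤ L) (hδ : 0 ≤ δ) {g g' : Torus d → ℝ}
    (hg : TorusLip L g) (h : ∀ x, g x + δ ≤ g' x) (x : Cyl d) :
    sd (under g') x + δ / (1 + L) ≤ sd (under g) x := by
  refine sd_add_le (by positivity) (under_nonempty g) (under_compl_nonempty g') ?_ x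
  intro a ha y hy
  have h1 := hg.gap_le hL y a
  have h2 : (1 + L) * dist (eucl y) (eucl a) ≤ δ := by
    rw [le_div_iff₀ (by positivity)] at hy; linarith
  have := h y.1
  simp only [mem_under] at ha ⊢
  linarith

/-- Turns the translated weight of the comparison principle into the signed distance from a
translated subgraph. -/
theorem sd_sub (g : Torus d → ℝ) (x v : Cyl d) :
    sd (under g) (x - v) = sd (under fun y => g (y - v.1) + v.2) x := by
  have key : ∀ A : Set (Cyl d), distTo (x - v) A = distTo x {y | y - v ∈ A} := by
    intro A
    rcases A.eq_empty_or_nonempty with rfl | ⟨a, ha⟩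
    · simp [distTo]
    apply le_antisymm
    · refine le_distTo ⟨a + v, by simpa⟩ fun y hy => ?_
      rw [← dist_eucl_sub_right x y v]
      exact distTo_le hy
    · refine le_distTo ⟨a, ha⟩ fun y hy => ?_
      have : distTo x {y | y - v ∈ A} ≤ _ := distTo_le (x := x) (a := y + v) (by simpa using hy)
      rwa [← dist_eucl_sub_right _ _ v, add_sub_cancel_right] at this
  have h : {y : Cyl d | y - v ∈ under g} = under fun y => g (y - v.1) + v.2 := by
    ext y; simp [under, sub_lt_iff_lt_add]
  unfold sd
  rw [key, key, ← h]
  rfl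

theorem le_sd_under {L : ℝ} (hL : 0 ≤ L) {g : Torus d → ℝ} (hg : TorusLip L g) {x : Cyl d}
    (hx : x ∉ under g) : |x.2 - g x.1| / (1 + L) ≤ sd (under g) x := by
  rw [sd, distTo_eq_zero (A := (under g)ᶜ) hx, sub_zero]
  refine le_distTo (under_nonempty g) fun a ha => ?_
  rw [div_le_iff₀ (by positivity), abs_of_nonneg (by simpa using hx)]
  have := hg.gap_le hL x a
  simp only [mem_under] at ha
  linarith

theorem sd_under_le {L : ℝ} (hL : 0 ≤ L) {g : Torus d → ℝ} (hg : TorusLip L g) {x : Cyl d}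
    (hx : x ∈ under g) : |x.2 - g x.1| / (1 + L) ≤ -sd (under g) x := by
  rw [sd, distTo_eq_zero hx, zero_sub, neg_neg]
  refine le_distTo (under_compl_nonempty g) fun a ha => ?_
  simp only [mem_under, Set.mem_compl_iff, not_lt] at ha hx
  rw [div_le_iff₀ (by positivity), abs_of_neg (by linarith)]
  have := hg.gap_le hL a x
  rw [dist_comm] at this
  linarith

/-- The extra `1` only avoids a limit: the point of height `g x.1` is not in the open subgraph, the
one of height `g x.1 - 1` is. -/
theorem abs_sd_under_le (g : Torus d → ℝ) (x : Cyl d) :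
    |sd (under g) x| ≤ 1 + |x.2 - g x.1| := by
  have h : ∀ (A : Set (Cyl d)) (s : ℝ), (x.1, s) ∈ A → distTo x A ≤ |x.2 - s| := by
    intro A s hs
    refine (distTo_le hs).trans ((dist_le_add _ _).trans_eq ?_)
    simp [torusDist_self]
  have h1 := h (under g) (g x.1 - 1) (by simp)
  have h2 := h (under g)ᶜ (g x.1) (by simp)
  have h3 : |x.2 - (g x.1 - 1)| ≤ 1 + |x.2 - g x.1| := by
    have : x.2 - (g x.1 - 1) = 1 + (x.2 - g x.1) := by ring
    rw [this]
    exact (abs_add_le _ _).trans_eq (by simp)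
  have h4 := distTo_nonneg x (under g)
  have h5 := distTo_nonneg x (under g)ᶜ
  rw [sd, abs_le]
  constructor <;> linarith

/-! ### Measure of regions between graphs, and translations -/

instance : (volume : Measure (Cyl d)).IsAddLeftInvariant :=
  Measure.prod.instIsAddLeftInvariant (μ := volume) (ν := volume)

theorem volume_torus : volume (Set.univ : Set (Torus d)) = 1 := by
  have h : volume (Set.univ : Set UnitAddCircle) = 1 := UnitAddCircle.measure_univ
  rw [← Set.pi_univ Set.univ, volume_pi_pi]
  simp [h]

/-- A measurable set all of whose vertical slices have measure `c` has measure `c`. -/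
theorem volume_eq_of_slices {S : Set (Cyl d)} (hS : MeasurableSet S) {c : ℝ≥0∞}
    (h : ∀ x, volume (Prod.mk x ⁻¹' S) = c) : volume S = c := by
  rw [Measure.volume_eq_prod, Measure.prod_apply hS]
  simp [h, volume_torus]

theorem volume_Ico_graph {g : Torus d → ℝ} (hg : Continuous g) (a b : ℝ) :
    volume {x : Cyl d | g x.1 + a ≤ x.2 ∧ x.2 < g x.1 + b} = ENNReal.ofReal (b - a) := by
  have h1 : Continuous fun x : Cyl d => g x.1 := hg.comp continuous_fst
  refine volume_eq_of_slices ?_ fun x => ?_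
  · exact (measurableSet_le (h1.add continuous_const).measurable measurable_snd).inter
      (measurableSet_lt measurable_snd (h1.add continuous_const).measurable)
  · change volume (Set.Ico (g x + a) (g x + b)) = _
    rw [Real.volume_Ico]; ring_nf

theorem volume_Icc_graph {g : Torus d → ℝ} (hg : Continuous g) (a : ℝ) :
    volume {x : Cyl d | |x.2 - g x.1| ≤ a} = ENNReal.ofReal (2 * a) := by
  have h1 : Continuous fun x : Cyl d => g x.1 := hg.comp continuous_fst
  refine volume_eq_of_slices ?_ fun x => ?_
  · exact measurableSet_le (continuous_snd.sub h1).abs.measurable measurable_const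
  · have : Prod.mk x ⁻¹' {x : Cyl d | |x.2 - g x.1| ≤ a} = Metric.closedBall (g x) a := by
      ext s; simp [Real.dist_eq]
    rw [this, Real.volume_closedBall]

theorem volume_graph {g : Torus d → ℝ} (hg : Continuous g) :
    volume {x : Cyl d | x.2 = g x.1} = 0 := by
  have := volume_Icc_graph hg 0
  simpa [sub_eq_zero] using this

theorem ae_ne_graph {g : Torus d → ℝ} (hg : Continuous g) : ∀ᵐ x : Cyl d, x.2 ≠ g x.1 := by
  rw [ae_iff]; simpa using volume_graph hg

/-- The translate `F + v`. -/
def shift (v : Cyl d) (F : Set (Cyl d)) : Set (Cyl d) := {x | x - v ∈ F}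

@[simp] theorem mem_shift {v x : Cyl d} {F : Set (Cyl d)} : x ∈ shift v F ↔ x - v ∈ F := Iff.rfl

theorem image_add_eq_shift (v : Cyl d) (F : Set (Cyl d)) : (fun x => x + v) '' F = shift v F := by
  ext x
  simp only [Set.mem_image, mem_shift]
  exact ⟨by rintro ⟨y, hy, rfl⟩; simpa, fun h => ⟨x - v, h, by simp⟩⟩

theorem measurePreserving_sub (v : Cyl d) :
    MeasurePreserving (fun x : Cyl d => x - v) volume volume :=
  measurePreserving_sub_right volume v

theorem nullMeasurableSet_shift {v : Cyl d} {F : Set (Cyl d)} (hF : NullMeasurableSet F volume) :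
    NullMeasurableSet (shift v F) volume :=
  hF.preimage (measurePreserving_sub v).quasiMeasurePreserving

theorem volume_shift {v : Cyl d} {F : Set (Cyl d)} (hF : NullMeasurableSet F volume) :
    volume (shift v F) = volume F :=
  (measurePreserving_sub v).measure_preimage hF

/-! ### Balls and density points of Lipschitz subgraphs -/

theorem dist_eucl_le_of_mem_closedBall {x y : Cyl d} {ρ : ℝ} (h : y ∈ Metric.closedBall x ρ) :
    dist (eucl y) (eucl x) ≤ (d + 1) * ρ := by
  rw [Metric.mem_closedBall, Prod.dist_eq, max_le_iff] at h
  have hρ : 0 ≤ ρ := dist_nonneg.trans h.1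
  have hT : torusDist y.1 x.1 ≤ d * ρ := by
    rw [torusDist_eq]
    refine Real.sqrt_le_iff.2 ⟨by positivity, ?_⟩
    have h1 : ∑ i, ‖y.1 i - x.1 i‖ ^ 2 ≤ ∑ _i : Fin (d - 1), ρ ^ 2 := by
      gcongr with i
      rw [← dist_eq_norm]
      exact (dist_le_pi_dist _ _ i).trans h.1
    have h2 : ((d - 1 : ℕ) : ℝ) ≤ d ^ 2 := by
      have : d - 1 ≤ d ^ 2 := (Nat.sub_le d 1).trans (Nat.le_self_pow two_ne_zero d)
      exact_mod_cast this
    simp only [Finset.sum_const, Finset.card_univ, Fintype.card_fin, nsmul_eq_mul] at h1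
    nlinarith [sq_nonneg ρ]
  have h2 : |y.2 - x.2| ≤ ρ := h.2
  linarith [dist_le_add y x]

theorem cylBall_subset_closedBall (x : Cyl d) {r : ℝ} (hr : 0 ≤ r) :
    cylBall x r ⊆ Metric.closedBall x r := by
  intro y hy
  have hy : dist (eucl y) (eucl x) < r := hy
  rw [Metric.mem_closedBall, Prod.dist_eq, max_le_iff, dist_pi_le_iff hr]
  refine ⟨fun i => ?_, (abs_sub_le_dist y x).trans hy.le⟩
  rw [dist_eq_norm]
  refine le_trans ?_ ((torusDist_le_dist y x).trans hy.le)
  rw [torusDist_eq]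
  refine Real.le_sqrt_of_sq_le ?_
  exact Finset.single_le_sum (f := fun i => ‖y.1 i - x.1 i‖ ^ 2) (fun i _ => sq_nonneg _)
    (Finset.mem_univ i)

theorem volume_closedBall_cyl (x : Cyl d) {r : ℝ} (hr : 0 ≤ r) :
    volume (Metric.closedBall x r) =
      ENNReal.ofReal (min 1 (2 * r)) ^ (d - 1) * ENNReal.ofReal (2 * r) := by
  have h : ∀ a : UnitAddCircle,
      volume (Metric.closedBall a r) = ENNReal.ofReal (min 1 (2 * r)) := fun a =>
    AddCircle.volume_closedBall 1 r
  rw [← Prod.mk.eta (p := x), ← closedBall_prod_same, Measure.volume_eq_prod, Measure.prod_prod,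
    Real.volume_closedBall, volume_pi_closedBall _ hr]
  simp [h]

theorem isOpen_cylBall (x : Cyl d) (r : ℝ) : IsOpen (cylBall x r) :=
  isOpen_lt (continuous_eucl.dist continuous_const) continuous_const

theorem volume_cylBall_pos (x : Cyl d) {r : ℝ} (hr : 0 < r) : 0 < volume (cylBall x r) :=
  (isOpen_cylBall x r).measure_pos _ ⟨x, by simpa [cylBall] using hr⟩

theorem volume_cylBall_lt_top (x : Cyl d) {r : ℝ} (hr : 0 ≤ r) : volume (cylBall x r) < ∞ := by
  refine (measure_mono (cylBall_subset_closedBall x hr)).trans_lt ?_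
  rw [volume_closedBall_cyl x hr]
  exact ENNReal.mul_lt_top (ENNReal.pow_lt_top ENNReal.ofReal_lt_top) ENNReal.ofReal_lt_top

/-- Small balls of comparable radii have comparable volumes. -/
theorem mul_volume_cylBall_le (x y : Cyl d) {κ r : ℝ} (hκ : 0 ≤ κ) (hr : 0 ≤ r)
    (h1 : 2 * (κ * r) ≤ 1) :
    ENNReal.ofReal κ ^ (d - 1) * ENNReal.ofReal κ * volume (cylBall x r) ≤
      volume (Metric.closedBall y (κ * r)) := by
  have h2 : volume (cylBall x r) ≤ ENNReal.ofReal (2 * r) ^ (d - 1) * ENNReal.ofReal (2 * r) := by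
    refine (measure_mono (cylBall_subset_closedBall x hr)).trans ?_
    rw [volume_closedBall_cyl x hr]
    gcongr
    exact min_le_right _ _
  rw [volume_closedBall_cyl y (by positivity), min_eq_right h1]
  refine (mul_le_mul_right h2 _).trans_eq ?_
  rw [show 2 * (κ * r) = κ * (2 * r) by ring, ENNReal.ofReal_mul hκ, mul_pow]
  ring

theorem lebRep_congr {E F : Set (Cyl d)} (h : E =ᵐ[volume] F) : lebRep E = lebRep F := by
  ext x
  have : ∀ r, volume (E ∩ cylBall x r) = volume (F ∩ cylBall x r) := fun r =>
    measure_congr (h.inter (ae_eq_refl _))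
  simp only [lebRep, Set.mem_ofPred_eq, this]

/-- Below the graph small balls are inside. On or above it, a fixed fraction of every small ball
lies above the graph, so the density cannot be one; hence the representative is the open subgraph.
-/
theorem lebRep_under {L : ℝ} (hL : 0 ≤ L) {g : Torus d → ℝ} (hg : TorusLip L g) :
    lebRep (under g) = under g := by
  ext x
  constructor
  · intro hx
    by_contra hxg
    simp only [mem_under, not_lt] at hxg
    -- Chosen so that the sup-ball of radius `κ r` centred `r / 2` above `x` stays in the Euclidean
    -- ball of radius `r` and above the graph; the factor `d + 1` compares the two distances.
    set κ : ℝ := 1 / (4 * (1 + L) * (d + 1)) with hκ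
    have hκ0 : 0 < κ := by positivity
    have hκ1 : (d + 1) * κ * (1 + L) = 1 / 4 := by rw [hκ]; field_simp
    set k : ℝ≥0∞ := ENNReal.ofReal κ ^ (d - 1) * ENNReal.ofReal κ with hk
    have hk0 : k ≠ 0 := by
      simp [hk, hκ0]
    have hk1 : k ≠ ∞ := ENNReal.mul_ne_top (ENNReal.pow_ne_top ENNReal.ofReal_ne_top)
      ENNReal.ofReal_ne_top
    have hev : ∀ᶠ r : ℝ in 𝓝[>] 0,
        volume (under g ∩ cylBall x r) / volume (cylBall x r) ≤ 1 - k := by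
      have hr0 : (0 : ℝ) < 1 / (2 * κ) := by positivity
      filter_upwards [Ioo_mem_nhdsGT hr0] with r hr
      have hr1 : 2 * (κ * r) ≤ 1 := by
        have := hr.2.le
        rw [le_div_iff₀ (by positivity)] at this
        linarith
      set y : Cyl d := (x.1, x.2 + r / 2) with hy
      have hyx : dist (eucl y) (eucl x) ≤ r / 2 := by
        refine (dist_le_add y x).trans_eq ?_
        simp [hy, torusDist_self, abs_of_pos (half_pos hr.1)]
      have hsub : Metric.closedBall y (κ * r) ⊆ cylBall x r \ under g := by
        intro z hz
        have hzy := dist_eucl_le_of_mem_closedBall hz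
        have h3 : (1 + L) * dist (eucl z) (eucl y) ≤ r / 4 := by
          have := mul_le_mul_of_nonneg_left hzy (show 0 ≤ 1 + L by positivity)
          nlinarith
        have h4 : dist (eucl z) (eucl y) ≤ r / 4 := by
          nlinarith [dist_nonneg (x := eucl z) (y := eucl y)]
        refine ⟨?_, ?_⟩
        · have := dist_triangle (eucl z) (eucl y) (eucl x)
          change dist (eucl z) (eucl x) < r
          linarith [hr.1]
        · have h5 := hg.gap_le hL y z
          rw [dist_comm] at h5
          simp only [hy] at h5
          simp only [mem_under, not_lt]
          linarith [hr.1]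
      have hV0 := (volume_cylBall_pos x hr.1).ne'
      have hV1 := (volume_cylBall_lt_top x hr.1.le).ne
      have h6 : volume (under g ∩ cylBall x r) + k * volume (cylBall x r)
          ≤ volume (cylBall x r) := by
        refine (add_le_add le_rfl ((mul_volume_cylBall_le x y hκ0.le hr.1.le hr1).trans
          (measure_mono hsub))).trans_eq ?_
        rw [Set.inter_comm]
        exact measure_inter_add_sdiff _ (isOpen_under hg.continuous).measurableSet
      rw [ENNReal.div_le_iff hV0 hV1, ENNReal.sub_mul (fun _ _ => hV1), one_mul]
      exact ENNReal.le_sub_of_add_le_right (ENNReal.mul_ne_top hk1 hV1) h6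
    have h7 := le_of_tendsto hx hev
    exact h7.not_gt (ENNReal.sub_lt_self ENNReal.one_ne_top one_ne_zero hk0)
  · intro hx
    have hx : x.2 < g x.1 := hx
    have hr0 : 0 < (g x.1 - x.2) / (1 + L) := div_pos (by linarith) (by positivity)
    refine tendsto_const_nhds.congr' ?_
    filter_upwards [Ioo_mem_nhdsGT hr0] with r hr
    have hsub : cylBall x r ⊆ under g := by
      intro y hy
      have h1 := hg.gap_le hL y x
      have h2 : dist (eucl y) (eucl x) < (g x.1 - x.2) / (1 + L) := lt_trans hy hr.2
      rw [lt_div_iff₀ (by positivity)] at h2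
      simp only [mem_under]
      linarith
    rw [Set.inter_eq_right.2 hsub, ENNReal.div_self (volume_cylBall_pos x hr.1).ne'
      (volume_cylBall_lt_top x hr.1.le).ne]

/-! ### From cone invariance to Lipschitz subgraphs -/

/-- A set which is almost invariant under all translations in the directions of the open cone
`{s > L |τ|}` is, up to null sets, the subgraph of an `L`-Lipschitz function. -/
theorem exists_under_of_cone {L R : ℝ} (hL : 0 ≤ L) {F : Set (Cyl d)} (hF : IsBetween R F)
    (h : ∀ (τ : Torus d) (s : ℝ), L * torusDist τ 0 < s → volume (F \ shift (τ, s) F) = 0) :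
    ∃ g : Torus d → ℝ, TorusLip L g ∧ (∀ x, |g x| ≤ R) ∧ F =ᵐ[volume] under g := by
  obtain ⟨F', hF'm, hFF'⟩ := hF.1
  have hcone : ∀ y : Cyl d, IsOpen {z : Cyl d | L * torusDist z.1 y.1 < y.2 - z.2} := fun y =>
    isOpen_lt (continuous_const.mul ((continuous_torusDist_left y.1).comp continuous_fst))
      (continuous_const.sub continuous_snd)
  have hK : MeasurableSet {v : Cyl d | L * torusDist v.1 0 < v.2} :=
    measurableSet_lt (continuous_const.mul
      ((continuous_torusDist_left 0).comp continuous_fst)).measurable measurable_snd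
  have h1 : ∀ᵐ v : Cyl d, ∀ᵐ y : Cyl d, L * torusDist v.1 0 < v.2 → y ∈ F' → y - v ∈ F' := by
    refine Eventually.of_forall fun v => ?_
    by_cases hv : L * torusDist v.1 0 < v.2
    · have h2 : ∀ᵐ y : Cyl d, y ∈ F ↔ y ∈ F' := hFF'.mem_iff
      have h3 := (measurePreserving_sub v).quasiMeasurePreserving.ae h2
      have h4 : ∀ᵐ y : Cyl d, y ∉ F \ shift v F := measure_eq_zero_iff_ae_notMem.1 (h v.1 v.2 hv)
      filter_upwards [h2, h3, h4] with y e2 e3 e4 _ hy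
      by_contra hc
      exact e4 ⟨e2.2 hy, fun hc' => hc (e3.1 hc')⟩
    · exact Eventually.of_forall fun y hv' => absurd hv' hv
  -- Fubini: for almost every `y` in the set, almost all of the downward cone with vertex `y` is in
  -- the set.
  have h2 : ∀ᵐ y : Cyl d, ∀ᵐ v : Cyl d, L * torusDist v.1 0 < v.2 → y ∈ F' → y - v ∈ F' := by
    refine (Measure.ae_ae_comm ?_).1 h1
    have e1 : MeasurableSet {p : Cyl d × Cyl d | L * torusDist p.1.1 0 < p.1.2} :=
      measurable_fst hK
    have e2 : MeasurableSet {p : Cyl d × Cyl d | p.2 ∈ F'} := measurable_snd hF'm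
    have e3 : MeasurableSet {p : Cyl d × Cyl d | p.2 - p.1 ∈ F'} :=
      (measurable_snd.sub measurable_fst) hF'm
    exact e1.imp (e2.imp e3)
  -- `N` collects the good vertices; `g` will be the upper envelope of their cones.
  set N : Set (Cyl d) := {y | y.2 < R ∧
    ∀ᵐ z : Cyl d, L * torusDist z.1 y.1 < y.2 - z.2 → z ∈ F'} with hN
  have hNF : ∀ᵐ y : Cyl d, y ∈ F' → y ∈ N := by
    filter_upwards [h2, hFF'.mem_iff] with y hy hyF hyF'
    refine ⟨hF.2.2 (hyF.2 hyF'), ?_⟩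
    have e := (quasiMeasurePreserving_sub_left (volume : Measure (Cyl d)) y).ae hy
    filter_upwards [e] with z hz hzy
    have e1 : torusDist (y - z).1 0 = torusDist z.1 y.1 := by
      rw [torusDist_comm z.1, ← torusDist_sub_right y.1 z.1 z.1]; simp
    rw [e1, sub_sub_cancel] at hz
    exact hz hzy hyF'
  -- Almost every point below height `-R` is a good vertex, which makes the envelope at least `-R`.
  have hNex : ∀ (x : Torus d) (ε : ℝ), 0 < ε → ∃ y ∈ N, -R - ε < y.2 - L * torusDist x y.1 := by
    intro x ε hε
    set U : Set (Cyl d) := {y | y.2 < -R ∧ -R - ε < y.2 - L * torusDist y.1 x} with hU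
    have hUo : IsOpen U := (isOpen_lt continuous_snd continuous_const).inter
      (isOpen_lt continuous_const (continuous_snd.sub (continuous_const.mul
        ((continuous_torusDist_left x).comp continuous_fst))))
    have hUn : U.Nonempty := ⟨(x, -R - ε / 2), by
      simp only [hU, Set.mem_ofPred_eq, torusDist_self]; constructor <;> linarith⟩
    have hpos : ∃ᵐ y : Cyl d, y ∈ U := by
      rw [frequently_ae_mem_iff]; exact (hUo.measure_pos _ hUn).ne'
    obtain ⟨y, hyU, hyF, hyN⟩ := (hpos.and_eventually (hFF'.mem_iff.and hNF)).exists
    refine ⟨y, hyN (hyF.1 (hF.2.1 hyU.1)), ?_⟩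
    rw [torusDist_comm]; exact hyU.2
  set S : Torus d → Set ℝ := fun x => (fun y : Cyl d => y.2 - L * torusDist x y.1) '' N with hS
  have hSne : ∀ x, (S x).Nonempty := fun x => by
    obtain ⟨y, hy, -⟩ := hNex x 1 one_pos
    exact ⟨_, y, hy, rfl⟩
  have hSR : ∀ x, R ∈ upperBounds (S x) := by
    rintro x _ ⟨y, hy, rfl⟩
    have := mul_nonneg hL (torusDist_nonneg x y.1)
    have := hy.1
    dsimp only
    linarith
  have hbdd : ∀ x, BddAbove (S x) := fun x => ⟨R, hSR x⟩
  set g : Torus d → ℝ := fun x => sSup (S x) with hgdef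
  have hlip : TorusLip L g := by
    have key : ∀ x x', g x ≤ g x' + L * torusDist x x' := by
      intro x x'
      refine csSup_le (hSne x) ?_
      rintro _ ⟨y, hy, rfl⟩
      have e1 : y.2 - L * torusDist x' y.1 ≤ g x' := le_csSup (hbdd x') ⟨y, hy, rfl⟩
      have e2 := mul_le_mul_of_nonneg_left (torusDist_triangle x' x y.1) hL
      rw [torusDist_comm x' x] at e2
      dsimp only
      linarith
    intro x x'
    rw [abs_le]
    have := key x' x
    rw [torusDist_comm] at this
    constructor <;> linarith [key x x']
  refine ⟨g, hlip, fun x => abs_le.2 ⟨?_, csSup_le (hSne x) (hSR x)⟩, ?_⟩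
  · refine le_of_forall_pos_lt_add fun ε hε => ?_
    obtain ⟨y, hy, hlt⟩ := hNex x ε hε
    have : y.2 - L * torusDist x y.1 ≤ g x := le_csSup (hbdd x) ⟨y, hy, rfl⟩
    linarith
  · refine hFF'.trans ?_
    -- Each cone lies in the set up to a null set; by the Lindelöf property countably many cones
    -- have the same union, so the exceptional sets remain null together.
    obtain ⟨T, hT, hTU⟩ := TopologicalSpace.isOpen_iUnion_countable
      (fun y : N => {z : Cyl d | L * torusDist z.1 y.1.1 < y.1.2 - z.2}) fun y => hcone y
    have hae : ∀ᵐ z : Cyl d, ∀ y ∈ T, L * torusDist z.1 y.1.1 < y.1.2 - z.2 → z ∈ F' := by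
      rw [ae_ball_iff hT]
      exact fun y _ => y.2.2
    filter_upwards [hae, hNF, ae_ne_graph hlip.continuous] with z hz hzN hzg
    refine propext ⟨fun hzF => ?_, fun hzu => ?_⟩
    · have hle : z.2 ≤ g z.1 := by
        refine le_csSup (hbdd z.1) ⟨z, hzN hzF, ?_⟩
        simp [torusDist_self]
      exact lt_of_le_of_ne hle hzg
    · obtain ⟨_, ⟨y, hy, rfl⟩, hlt⟩ := exists_lt_of_lt_csSup (hSne z.1) (show z.2 < g z.1 from hzu)
      have hmem : z ∈ ⋃ y : N, {z : Cyl d | L * torusDist z.1 y.1.1 < y.1.2 - z.2} := by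
        refine Set.mem_iUnion.2 ⟨⟨y, hy⟩, ?_⟩
        dsimp only at hlt
        simp only [Set.mem_ofPred_eq]
        linarith
      rw [← hTU] at hmem
      obtain ⟨y, hyT, hzy⟩ := Set.mem_iUnion₂.1 hmem
      exact hz y hyT hzy

/-! ### Almost minimizers and the comparison principle -/

theorem nullMeasurableSet_strip (R : ℝ) : NullMeasurableSet (strip d R) volume :=
  (measurable_snd measurableSet_Ioo).nullMeasurableSet

theorem volume_strip_lt_top (R : ℝ) : volume (strip d R) < ∞ := by
  refine (measure_mono (t := {x : Cyl d | 0 + -R ≤ x.2 ∧ x.2 < 0 + R}) ?_).trans_lt ?_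
  · intro x hx; exact ⟨by simpa using hx.1.le, by simpa using hx.2⟩
  · rw [volume_Ico_graph (g := fun _ => 0) continuous_const]; exact ENNReal.ofReal_lt_top

/-- The real-valued incremental functional with a general weight. -/
noncomputable def weightedEnergy (P : Set (Cyl d) → ℝ≥0∞) (R h : ℝ) (w : Cyl d → ℝ)
    (F : Set (Cyl d)) : ℝ :=
  (P F).toReal + 1 / h * ∫ x in F ∩ strip d R, w x

/-- Minimizers, up to an error `ε`, of the functional with weight `w`. -/
def IsAlmostMin (P : Set (Cyl d) → ℝ≥0∞) (R h : ℝ) (w : Cyl d → ℝ) (ε : ℝ) (F : Set (Cyl d)) :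
    Prop :=
  IsBetween R F ∧ P F < ∞ ∧ ∀ G, IsBetween R G → P G < ∞ →
    weightedEnergy P R h w F ≤ weightedEnergy P R h w G + ε

section Comparison

variable {P : Set (Cyl d) → ℝ≥0∞}

theorem IsGeneralizedPerimeter.shift (hP : IsGeneralizedPerimeter P) (v : Cyl d) {F : Set (Cyl d)}
    (hF : NullMeasurableSet F volume) : P (shift v F) = P F := by
  rw [← image_add_eq_shift, hP.translate F v hF]

/-- Comparison principle for almost minimizers; the set on the right is translated upwards. -/
theorem mul_volume_diff_shift_le (hP : IsGeneralizedPerimeter P) {R h : ℝ} (hh : 0 < h)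
    {w₁ w₂ : Cyl d → ℝ} (hw₁ : IntegrableOn w₁ (strip d R)) (hw₂ : IntegrableOn w₂ (strip d R))
    {ε₁ ε₂ ρ : ℝ} {F₁ F₂ : Set (Cyl d)}
    (h₁ : IsAlmostMin P R h w₁ ε₁ F₁) (h₂ : IsAlmostMin P R h w₂ ε₂ F₂)
    {v : Cyl d} (hv : 0 < v.2) (hw : ∀ x, w₂ (x - v) + ρ ≤ w₁ x) :
    ρ * volume.real (F₁ \ shift v F₂) ≤ h * (ε₁ + ε₂) := by
  obtain ⟨hF₁, hP₁, hm₁⟩ := h₁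
  obtain ⟨hF₂, hP₂, hm₂⟩ := h₂
  have hsm := nullMeasurableSet_shift (v := v) hF₂.1
  set F' := FlatFlow.shift v F₂ with hF'
  have hPF' : P F' = P F₂ := hP.shift v hF₂.1
  set D := F₁ \ F' with hD
  have hDm : NullMeasurableSet D volume := hF₁.1.diff hsm
  have hDlow : ∀ x ∈ D, v.2 - R ≤ x.2 := by
    intro x hx
    by_contra hlt
    refine hx.2 (hF₂.2.1 ?_)
    simp only [Set.mem_ofPred_eq, Prod.snd_sub]
    linarith
  have hDup : ∀ x ∈ D, x.2 < R := fun x hx => hF₁.2.2 hx.1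
  have hDS : D ⊆ strip d R := fun x hx => ⟨by linarith [hDlow x hx], hDup x hx⟩
  -- Since `v` points upwards, the intersection still contains everything below `-R`, and the union,
  -- once moved back down, stays below `R`.
  have hA : IsBetween R (F₁ ∩ F') := by
    refine ⟨hF₁.1.inter hsm, fun x hx => ⟨hF₁.2.1 hx, hF₂.2.1 ?_⟩, fun x hx => hF₁.2.2 hx.1⟩
    simp only [Set.mem_ofPred_eq, Prod.snd_sub] at hx ⊢
    linarith
  set B := FlatFlow.shift (-v) (F₁ ∪ F') with hB
  have hF₂B : F₂ ⊆ B := fun x hx => Or.inr (by simpa [hF'] using hx)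
  have hBb : IsBetween R B := by
    refine ⟨nullMeasurableSet_shift (hF₁.1.union hsm), fun x hx => hF₂B (hF₂.2.1 hx), ?_⟩
    rintro x (hx | hx)
    · have := hF₁.2.2 hx
      simp only [Set.mem_ofPred_eq, Prod.snd_sub, Prod.snd_neg] at this ⊢
      linarith
    · exact hF₂.2.2 (by simpa [hF'] using hx)
  have hPB : P B = P (F₁ ∪ F') := hP.shift _ (hF₁.1.union hsm)
  have hsub := hP.submodular F₁ F' hF₁.1 hsm
  rw [← hPB, hPF'] at hsub
  have hfin : P F₁ + P F₂ ≠ ∞ := ENNReal.add_ne_top.2 ⟨hP₁.ne, hP₂.ne⟩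
  have hfin' := ne_top_of_le_ne_top hfin hsub
  have hPBf : P B ≠ ∞ := (ENNReal.add_ne_top.1 hfin').1
  have hPAf : P (F₁ ∩ F') ≠ ∞ := (ENNReal.add_ne_top.1 hfin').2
  have hsubR : (P B).toReal + (P (F₁ ∩ F')).toReal ≤ (P F₁).toReal + (P F₂).toReal := by
    rw [← ENNReal.toReal_add hPBf hPAf, ← ENNReal.toReal_add hP₁.ne hP₂.ne]
    exact ENNReal.toReal_mono hfin hsub
  have e₁ : (∫ x in (F₁ ∩ F') ∩ strip d R, w₁ x) + ∫ x in D, w₁ x = ∫ x in F₁ ∩ strip d R, w₁ x := by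
    have e := integral_inter_add_sdiff₀ hsm
      (hw₁.mono_set (Set.inter_subset_right (s := F₁) (t := strip d R)))
    have hset : (F₁ ∩ strip d R) \ F' = D := by
      ext x
      exact ⟨fun hx => ⟨hx.1.1, hx.2⟩, fun hx => ⟨⟨hx.1, hDS hx⟩, hx.2⟩⟩
    rwa [Set.inter_right_comm, hset] at e
  -- The strip is open, whereas `D` moved back may touch the level `-R`; that level is null.
  have hnull : ∀ᵐ x : Cyl d, x.2 ≠ -R := ae_ne_graph (g := fun _ => -R) continuous_const
  have hBD : ((B ∩ strip d R) \ F₂ : Set (Cyl d)) =ᵐ[volume] FlatFlow.shift (-v) D := by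
    filter_upwards [hnull] with x hx
    refine propext ⟨?_, fun hxD => ?_⟩
    · rintro ⟨⟨hxB, -⟩, hx2⟩
      have hx' : x - -v ∉ F' := by simpa [hF'] using hx2
      exact ⟨hxB.resolve_right hx', hx'⟩
    · have h1 := hDlow _ hxD
      have h2 := hDup _ hxD
      simp only [Prod.snd_sub, Prod.snd_neg] at h1 h2
      refine ⟨⟨Or.inl hxD.1, lt_of_le_of_ne (by linarith) hx.symm, by linarith⟩, ?_⟩
      have := hxD.2
      simpa [hF'] using this
  have hpre : (fun x : Cyl d => x - v) ⁻¹' (FlatFlow.shift (-v) D) = D := by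
    ext x; simp
  have hemb : MeasurableEmbedding fun x : Cyl d => x - v :=
    (MeasurableEquiv.subRight v).measurableEmbedding
  have e₂ : (∫ x in F₂ ∩ strip d R, w₂ x) + ∫ x in D, w₂ (x - v) = ∫ x in B ∩ strip d R, w₂ x := by
    have e := integral_inter_add_sdiff₀ hF₂.1
      (hw₂.mono_set (Set.inter_subset_right (s := B) (t := strip d R)))
    rwa [Set.inter_right_comm, Set.inter_eq_right.2 hF₂B, setIntegral_congr_set hBD,
      ← (measurePreserving_sub v).setIntegral_preimage_emb hemb w₂ (FlatFlow.shift (-v) D),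
      hpre] at e
  have hi₂ : IntegrableOn (fun x => w₂ (x - v)) D := by
    have h1 : IntegrableOn w₂ (FlatFlow.shift (-v) D) :=
      (hw₂.mono_set (Set.sdiff_subset.trans Set.inter_subset_right)).congr_set_ae hBD.symm
    have h2 := ((measurePreserving_sub v).integrableOn_comp_preimage hemb (f := w₂)
      (s := FlatFlow.shift (-v) D)).2 h1
    rwa [hpre] at h2
  have hi₁ : IntegrableOn w₁ D := hw₁.mono_set hDS
  have hDfin : volume D ≠ ∞ := ((measure_mono hDS).trans_lt (volume_strip_lt_top R)).ne
  have hρ : ρ * volume.real D ≤ (∫ x in D, w₁ x) - ∫ x in D, w₂ (x - v) := by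
    rw [← integral_sub hi₁ hi₂]
    have : ∫ _x in D, ρ = ρ * volume.real D := by
      rw [setIntegral_const, smul_eq_mul, mul_comm]
    rw [← this]
    refine integral_mono (integrableOn_const hDfin) (hi₁.sub hi₂) fun x => ?_
    linarith [hw x]
  have m₁ := hm₁ _ hA hPAf.lt_top
  have m₂ := hm₂ _ hBb hPBf.lt_top
  unfold weightedEnergy at m₁ m₂
  rw [← e₁] at m₁
  rw [← e₂] at m₂
  have hfinal : 1 / h * ((∫ x in D, w₁ x) - ∫ x in D, w₂ (x - v)) ≤ ε₁ + ε₂ := by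
    rw [mul_add] at m₁ m₂
    rw [mul_sub]
    linarith
  rw [one_div, inv_mul_le_iff₀ hh] at hfinal
  exact hρ.trans hfinal

end Comparison

/-! ### Existence of minimizers -/

/-- Lifting a set of `𝔐_R` by `s` adds the measure `s`. -/
theorem volume_shift_diff_le {R s : ℝ} (hs : 0 < s) {F : Set (Cyl d)} (hF : IsBetween R F) :
    volume.real (shift (0, s) F \ F) ≤ volume.real (F \ shift (0, s) F) + s := by
  have hm := nullMeasurableSet_shift (v := (0, s)) hF.1
  set T : Set (Cyl d) := {x | 0 + -R ≤ x.2 ∧ x.2 < 0 + (R + s)} with hT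
  have hTm : NullMeasurableSet T volume :=
    ((measurableSet_le measurable_const measurable_snd).inter
      (measurableSet_lt measurable_snd measurable_const)).nullMeasurableSet
  have hTfin : volume T ≠ ∞ := by
    rw [volume_Ico_graph (g := fun _ => 0) continuous_const]; exact ENNReal.ofReal_ne_top
  have hfin : ∀ A : Set (Cyl d), volume (A ∩ T) ≠ ∞ := fun A =>
    ne_top_of_le_ne_top hTfin (measure_mono Set.inter_subset_right)
  have h1 : shift (0, s) F \ F = (shift (0, s) F ∩ T) \ (F ∩ T) := by
    ext x
    constructor
    · rintro ⟨hx1, hx2⟩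
      have h3 := hF.2.2 hx1
      have h4 : ¬ x.2 < -R := fun h => hx2 (hF.2.1 h)
      simp only [Set.mem_ofPred_eq, Prod.snd_sub] at h3
      exact ⟨⟨hx1, by linarith, by linarith⟩, fun h => hx2 h.1⟩
    · rintro ⟨⟨hx1, hxT⟩, hx2⟩
      exact ⟨hx1, fun h => hx2 ⟨h, hxT⟩⟩
  have h2 : F \ shift (0, s) F = (F ∩ T) \ (shift (0, s) F ∩ T) := by
    ext x
    constructor
    · rintro ⟨hx1, hx2⟩
      have h3 := hF.2.2 hx1
      have h4 : ¬ x.2 - s < -R := fun h => hx2 (hF.2.1 (by simpa using h))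
      simp only [Set.mem_ofPred_eq] at h3
      exact ⟨⟨hx1, by linarith, by linarith⟩, fun h => hx2 h.1⟩
    · rintro ⟨⟨hx1, hxT⟩, hx2⟩
      exact ⟨hx1, fun h => hx2 ⟨h, hxT⟩⟩
  have h3 : volume (shift (0, s) F ∩ T) ≤ volume (F ∩ T) + ENNReal.ofReal s := by
    -- Beyond the lift of `F ∩ T`, only a layer of thickness `s`, lifted from below `-R`, can enter
    -- the slab `T`.
    have e1 : shift (0, s) F ∩ T ⊆
        shift (0, s) ((F ∩ T) ∪ {x : Cyl d | 0 + (-R - s) ≤ x.2 ∧ x.2 < 0 + -R}) := by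
      rintro x ⟨hx, hxT⟩
      have h5 := hF.2.2 hx
      simp only [Set.mem_ofPred_eq, Prod.snd_sub] at h5
      simp only [hT, Set.mem_ofPred_eq] at hxT
      by_cases hlt : x.2 - s < -R
      · exact Or.inr ⟨by simp only [Prod.snd_sub]; linarith, by simp only [Prod.snd_sub]; linarith⟩
      · exact Or.inl ⟨hx, by simp only [Prod.snd_sub]; linarith,
          by simp only [Prod.snd_sub]; linarith⟩
    refine (measure_mono e1).trans ?_
    have e2 : MeasurableSet {x : Cyl d | 0 + (-R - s) ≤ x.2 ∧ x.2 < 0 + -R} :=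
      (measurableSet_le measurable_const measurable_snd).inter
        (measurableSet_lt measurable_snd measurable_const)
    rw [volume_shift ((hF.1.inter hTm).union e2.nullMeasurableSet)]
    refine (measure_union_le _ _).trans (add_le_add le_rfl ?_)
    rw [volume_Ico_graph (g := fun _ => 0) continuous_const]
    ring_nf; exact le_rfl
  have h3' : volume.real (shift (0, s) F ∩ T) ≤ volume.real (F ∩ T) + s := by
    have := ENNReal.toReal_mono (ENNReal.add_ne_top.2 ⟨hfin F, ENNReal.ofReal_ne_top⟩) h3
    rwa [ENNReal.toReal_add (hfin F) ENNReal.ofReal_ne_top, ENNReal.toReal_ofReal hs.le] at this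
  rw [h1, h2]
  have k1 := measureReal_inter_add_sdiff₀ (s := shift (0, s) F ∩ T) (hF.1.inter hTm)
    (hfin _)
  have k2 := measureReal_inter_add_sdiff₀ (s := F ∩ T) (hm.inter hTm) (hfin _)
  rw [Set.inter_comm] at k2
  linarith

/-- A sequence of sets with summable consecutive differences converges in measure. -/
theorem exists_limit_set {F : ℕ → Set (Cyl d)} {R : ℝ} (hF : ∀ n, IsBetween R (F n)) {b : ℕ → ℝ≥0∞}
    (hb : ∑' n, b n ≠ ∞) (h : ∀ n, volume (F n ∆ F (n + 1)) ≤ b n) :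
    ∃ G, IsBetween R G ∧ Tendsto (fun n => volume (F n ∆ G)) atTop (𝓝 0) := by
  refine ⟨⋃ N, ⋂ n, F (N + n), ⟨?_, fun x hx => ?_, fun x hx => ?_⟩, ?_⟩
  · exact NullMeasurableSet.iUnion fun N => NullMeasurableSet.iInter fun n => (hF _).1
  · exact Set.mem_iUnion.2 ⟨0, Set.mem_iInter.2 fun n => (hF _).2.1 hx⟩
  · obtain ⟨N, hN⟩ := Set.mem_iUnion.1 hx
    exact (hF N).2.2 (Set.mem_iInter.1 hN 0)
  · refine tendsto_of_tendsto_of_tendsto_of_le_of_le tendsto_const_nhds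
      (ENNReal.tendsto_sum_nat_add b hb) (fun _ => zero_le) fun n => ?_
    -- The limit is the set-theoretic lower limit: a point whose membership never changes after
    -- index `n` belongs to it exactly when it belongs to `F n`.
    have hsub : F n ∆ (⋃ N, ⋂ k, F (N + k)) ⊆ ⋃ m, F (m + n) ∆ F (m + n + 1) := by
      intro x hx
      by_contra hc
      simp only [Set.mem_iUnion, Set.mem_symmDiff, not_exists] at hc
      have hall : ∀ m, x ∈ F (m + n) ↔ x ∈ F n := by
        intro m
        induction m with
        | zero => simp
        | succ m ih =>
          have := hc m
          rw [show m + 1 + n = m + n + 1 by ring]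
          tauto
      rcases hx with ⟨h1, h2⟩ | ⟨h1, h2⟩
      · refine h2 (Set.mem_iUnion.2 ⟨n, Set.mem_iInter.2 fun k => ?_⟩)
        rw [add_comm]; exact (hall k).2 h1
      · obtain ⟨N, hN⟩ := Set.mem_iUnion.1 h1
        exact h2 ((hall N).1 (Set.mem_iInter.1 hN n))
    exact (measure_mono hsub).trans ((measure_iUnion_le _).trans
      (ENNReal.tsum_le_tsum fun m => h _))

theorem abs_setIntegral_sub_le {R M : ℝ} {w : Cyl d → ℝ} (hw : IntegrableOn w (strip d R))
    (hM : ∀ x ∈ strip d R, |w x| ≤ M) {A B : Set (Cyl d)} (hA : NullMeasurableSet A volume)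
    (hB : NullMeasurableSet B volume) :
    |(∫ x in A ∩ strip d R, w x) - ∫ x in B ∩ strip d R, w x| ≤
      2 * M * volume.real ((A ∆ B) ∩ strip d R) := by
  have hfin : volume ((A ∆ B) ∩ strip d R) ≠ ∞ :=
    ((measure_mono Set.inter_subset_right).trans_lt (volume_strip_lt_top R)).ne
  have key : ∀ A B : Set (Cyl d), (A ∩ strip d R) \ B ⊆ (A ∆ B) ∩ strip d R := by
    rintro A B x ⟨⟨h1, h2⟩, h3⟩; exact ⟨Or.inl ⟨h1, h3⟩, h2⟩
  have bound : ∀ S : Set (Cyl d), S ⊆ (A ∆ B) ∩ strip d R →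
      |∫ x in S, w x| ≤ M * volume.real ((A ∆ B) ∩ strip d R) := by
    intro S hS
    have h0 : volume S < ∞ := (measure_mono hS).trans_lt hfin.lt_top
    rcases S.eq_empty_or_nonempty with rfl | ⟨x, hx⟩
    · rcases (strip d R).eq_empty_or_nonempty with h | ⟨x, hx⟩
      · simp [h]
      · simpa using mul_nonneg ((abs_nonneg _).trans (hM x hx)) measureReal_nonneg
    have hM0 : 0 ≤ M := (abs_nonneg _).trans (hM x (hS hx).2)
    refine (norm_setIntegral_le_of_norm_le_const (f := w) (C := M) h0 fun x hx => hM x (hS hx).2).trans ?_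
    exact mul_le_mul_of_nonneg_left (measureReal_mono hS hfin) hM0
  have e1 := integral_inter_add_sdiff₀ hB (hw.mono_set (Set.inter_subset_right (s := A)))
  have e2 := integral_inter_add_sdiff₀ hA (hw.mono_set (Set.inter_subset_right (s := B)))
  have e3 : A ∩ strip d R ∩ B = B ∩ strip d R ∩ A := by
    ext x; simp only [Set.mem_inter_iff]; tauto
  rw [e3] at e1
  rw [← e1, ← e2]
  have b1 := bound _ (key A B)
  have b2 := bound ((B ∩ strip d R) \ A) (by rw [symmDiff_comm]; exact key B A)
  rw [abs_le] at *
  constructor <;> linarith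

theorem isBetween_under {L R : ℝ} {g : Torus d → ℝ} (hg : TorusLip L g) (hR : ∀ x, |g x| ≤ R) :
    IsBetween R (under g) := by
  refine ⟨(isOpen_under hg.continuous).measurableSet.nullMeasurableSet, fun x hx => ?_,
    fun x hx => ?_⟩
  · exact lt_of_lt_of_le hx (abs_le.1 (hR x.1)).1
  · exact lt_of_lt_of_le hx (abs_le.1 (hR x.1)).2

/-- Existence of minimizers for strictly increasing weights: minimizing sequences are Cauchy. -/
theorem exists_isAlmostMin_zero {P : Set (Cyl d) → ℝ≥0∞} (hP : IsGeneralizedPerimeter P)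
    {R h : ℝ} (hh : 0 < h) {w : Cyl d → ℝ}
    (hwi : IntegrableOn w (strip d R)) {M : ℝ} (hM : ∀ x ∈ strip d R, |w x| ≤ M)
    {c : ℝ} (hc : 0 < c) (hmono : ∀ s : ℝ, 0 < s → ∀ x, w (x - (0, s)) + c * s ≤ w x)
    (hne : ∃ G, IsBetween R G ∧ P G < ∞) : ∃ F, IsAlmostMin P R h w 0 F := by
  set S : Set ℝ := {e | ∃ G, IsBetween R G ∧ P G < ∞ ∧ weightedEnergy P R h w G = e} with hS
  have hSne : S.Nonempty := by obtain ⟨G, h1, h2⟩ := hne; exact ⟨_, G, h1, h2, rfl⟩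
  have hSb : BddBelow S := by
    refine ⟨1 / h * -(2 * M * volume.real (strip d R)), ?_⟩
    rintro _ ⟨G, hG, -, rfl⟩
    have h1 := abs_setIntegral_sub_le hwi hM hG.1 (nullMeasurableSet_empty (μ := volume))
    simp only [Set.empty_inter, Measure.restrict_empty, integral_zero_measure, sub_zero] at h1
    have h2 : volume.real ((G ∆ ∅) ∩ strip d R) ≤ volume.real (strip d R) :=
      measureReal_mono Set.inter_subset_right (volume_strip_lt_top R).ne
    rcases (strip d R).eq_empty_or_nonempty with h3 | ⟨x, hx⟩
    · simp [h3, weightedEnergy]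
    have hM0 : 0 ≤ M := (abs_nonneg _).trans (hM x hx)
    have h4 := h1.trans (mul_le_mul_of_nonneg_left h2 (by positivity : 0 ≤ 2 * M))
    have h5 := mul_le_mul_of_nonneg_left (abs_le.1 h4).1 (by positivity : 0 ≤ 1 / h)
    have h6 : 0 ≤ (P G).toReal := ENNReal.toReal_nonneg
    unfold weightedEnergy
    linarith
  -- With `s = (1 / 2) ^ n`, the error satisfies `h * ε n = c * s ^ 2`, while a lift by `s` gains `c
  -- * s` in the weight: comparison then leaves measures of order `s`, which are summable.
  set ε : ℕ → ℝ := fun n => c / h * (1 / 4) ^ n with hε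
  have hε0 : ∀ n, 0 < ε n := fun n => by positivity
  have hex : ∀ n, ∃ F, IsBetween R F ∧ P F < ∞ ∧ weightedEnergy P R h w F < sInf S + ε n := by
    intro n
    obtain ⟨_, ⟨F, h1, h2, rfl⟩, h3⟩ := exists_lt_of_csInf_lt hSne (lt_add_of_pos_right _ (hε0 n))
    exact ⟨F, h1, h2, h3⟩
  choose F hF hPF hlt using hex
  have hSle : ∀ G, IsBetween R G → P G < ∞ → sInf S ≤ weightedEnergy P R h w G :=
    fun G h1 h2 => csInf_le hSb ⟨G, h1, h2, rfl⟩
  have hFm : ∀ n, IsAlmostMin P R h w (ε n) (F n) := fun n =>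
    ⟨hF n, hPF n, fun G h1 h2 => by linarith [hSle G h1 h2, hlt n]⟩
  have hdfin : ∀ A B : Set (Cyl d), IsBetween R A → IsBetween R B → ∀ s : ℝ, 0 ≤ s →
      volume (A \ shift (0, s) B) ≠ ∞ := by
    intro A B hA hB s hs
    refine ne_top_of_le_ne_top ?_ (measure_mono
      (t := {x : Cyl d | 0 + -R ≤ x.2 ∧ x.2 < 0 + R}) ?_)
    · rw [volume_Ico_graph (g := fun _ => 0) continuous_const]; exact ENNReal.ofReal_ne_top
    · rintro x ⟨hx1, hx2⟩
      have h1 := hA.2.2 hx1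
      have h2 : ¬ x.2 - s < -R := fun h => hx2 (hB.2.1 (by simpa using h))
      simp only [Set.mem_ofPred_eq] at h1
      exact ⟨by linarith, by linarith⟩
  have hsfin : ∀ B : Set (Cyl d), IsBetween R B → ∀ s : ℝ, 0 ≤ s →
      volume (shift (0, s) B \ B) ≠ ∞ := by
    intro B hB s hs
    refine ne_top_of_le_ne_top ?_ (measure_mono
      (t := {x : Cyl d | 0 + -R ≤ x.2 ∧ x.2 < 0 + (R + s)}) ?_)
    · rw [volume_Ico_graph (g := fun _ => 0) continuous_const]; exact ENNReal.ofReal_ne_top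
    · rintro x ⟨hx1, hx2⟩
      have h1 := hB.2.2 hx1
      have h2 : ¬ x.2 < -R := fun h => hx2 (hB.2.1 (by simpa using h))
      simp only [Set.mem_ofPred_eq, Prod.snd_sub] at h1
      exact ⟨by linarith, by linarith⟩
  have hquant : ∀ n i j, n ≤ i → n ≤ j → volume (F i \ F j) ≤ ENNReal.ofReal (5 * (1 / 2) ^ n) := by
    intro n i j hi hj
    set s : ℝ := (1 / 2) ^ n with hs
    have hs0 : 0 < s := by positivity
    have hεi : ∀ i, n ≤ i → h * ε i ≤ c * s ^ 2 := by
      intro i hi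
      have : (1 / 4 : ℝ) ^ i ≤ (1 / 4) ^ n := pow_le_pow_of_le_one (by norm_num) (by norm_num) hi
      have h2 : s ^ 2 = (1 / 4) ^ n := by rw [hs, ← pow_mul, mul_comm, pow_mul]; norm_num
      rw [h2, hε]
      calc h * (c / h * (1 / 4) ^ i) = c * (1 / 4) ^ i := by field_simp
        _ ≤ _ := by gcongr
    have k1 := mul_volume_diff_shift_le hP hh hwi hwi (hFm i) (hFm j) (v := (0, s)) hs0
      (hmono s hs0)
    have k2 := mul_volume_diff_shift_le hP hh hwi hwi (hFm j) (hFm j) (v := (0, s)) hs0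
      (hmono s hs0)
    have k3 := volume_shift_diff_le hs0 (hF j)
    have q1 : volume.real (F i \ shift (0, s) (F j)) ≤ 2 * s := by
      have : c * s * volume.real (F i \ shift (0, s) (F j)) ≤ c * s * (2 * s) := by
        nlinarith [hεi i hi, hεi j hj]
      exact le_of_mul_le_mul_left this (by positivity)
    have q2 : volume.real (F j \ shift (0, s) (F j)) ≤ 2 * s := by
      have : c * s * volume.real (F j \ shift (0, s) (F j)) ≤ c * s * (2 * s) := by
        nlinarith [hεi j hj]
      exact le_of_mul_le_mul_left this (by positivity)
    -- The first piece has measure at most `2 * s`; the second at most `2 * s + s` by comparing `F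
    -- j` with its own lift. Hence the factor `5`.
    have hsub : F i \ F j ⊆ (F i \ shift (0, s) (F j)) ∪ (shift (0, s) (F j) \ F j) := by
      rintro x ⟨h1, h2⟩
      by_cases h3 : x ∈ shift (0, s) (F j)
      · exact Or.inr ⟨h3, h2⟩
      · exact Or.inl ⟨h1, h3⟩
    refine (measure_mono hsub).trans ((measure_union_le _ _).trans ?_)
    rw [← ENNReal.ofReal_toReal (hdfin _ _ (hF i) (hF j) s hs0.le),
      ← ENNReal.ofReal_toReal (hsfin _ (hF j) s hs0.le),
      ← ENNReal.ofReal_add ENNReal.toReal_nonneg ENNReal.toReal_nonneg]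
    apply ENNReal.ofReal_le_ofReal
    simp only [Measure.real] at q1 q2 k3
    linarith
  have hsum : ∑' n : ℕ, ENNReal.ofReal (10 * (1 / 2) ^ n) ≠ ∞ := by
    have : Summable fun n : ℕ => (10 : ℝ) * (1 / 2) ^ n :=
      (summable_geometric_of_lt_one (by norm_num) (by norm_num)).mul_left 10
    exact this.tsum_ofReal_ne_top
  obtain ⟨G, hG, hGlim⟩ := exists_limit_set hF hsum fun n => by
    refine (measure_union_le _ _).trans ((add_le_add (hquant n n (n + 1) le_rfl (by lia))
      (hquant n (n + 1) n (by lia) le_rfl)).trans_eq ?_)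
    rw [← ENNReal.ofReal_add (by positivity) (by positivity)]
    ring_nf
  have hGlimR : ∀ r : ℝ, Tendsto (fun n => volume ((F n ∆ G) ∩ strip d r)) atTop (𝓝 0) := fun r =>
    tendsto_of_tendsto_of_tendsto_of_le_of_le tendsto_const_nhds hGlim (fun _ => zero_le)
      fun n => measure_mono Set.inter_subset_left
  have hlsc := hP.lsc G F hG.1 (fun n => (hF n).1) fun r _ => hGlimR r
  have hint : Tendsto (fun n => ∫ x in F n ∩ strip d R, w x) atTop
      (𝓝 (∫ x in G ∩ strip d R, w x)) := by
    rw [tendsto_iff_dist_tendsto_zero]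
    have h1 : Tendsto (fun n => 2 * M * volume.real ((F n ∆ G) ∩ strip d R)) atTop (𝓝 0) := by
      have := ((ENNReal.tendsto_toReal ENNReal.zero_ne_top).comp (hGlimR R)).const_mul (2 * M)
      simpa [Measure.real, Function.comp_def] using this
    exact squeeze_zero (fun _ => dist_nonneg)
      (fun n => abs_setIntegral_sub_le hwi hM (hF n).1 hG.1) h1
  have hE : Tendsto (fun n => weightedEnergy P R h w (F n)) atTop (𝓝 (sInf S)) := by
    have h1 : Tendsto (fun n => sInf S + ε n) atTop (𝓝 (sInf S)) := by
      have := ((tendsto_pow_atTop_nhds_zero_of_lt_one (r := (1 / 4 : ℝ)) (by norm_num)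
        (by norm_num)).const_mul (c / h)).const_add (sInf S)
      rwa [mul_zero, add_zero] at this
    exact tendsto_of_tendsto_of_tendsto_of_le_of_le tendsto_const_nhds h1
      (fun n => hSle _ (hF n) (hPF n)) fun n => (hlt n).le
  -- Energies and integrals both converge, hence so do the perimeters, and lower semicontinuity
  -- bounds `P G` by their limit.
  have hPlim : Tendsto (fun n => (P (F n)).toReal) atTop
      (𝓝 (sInf S - 1 / h * ∫ x in G ∩ strip d R, w x)) := by
    have := hE.sub (hint.const_mul (1 / h))
    refine this.congr fun n => ?_
    simp [weightedEnergy]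
  have hPlim' := ENNReal.tendsto_ofReal hPlim
  simp only [ENNReal.ofReal_toReal (hPF _).ne] at hPlim'
  rw [hPlim'.liminf_eq] at hlsc
  refine ⟨G, hG, hlsc.trans_lt ENNReal.ofReal_lt_top, fun G' h1 h2 => ?_⟩
  have h3 := ENNReal.toReal_le_of_le_ofReal
    (ge_of_tendsto' hPlim fun n => ENNReal.toReal_nonneg) hlsc
  have := hSle G' h1 h2
  unfold weightedEnergy at this ⊢
  linarith

/-! ### One step of the scheme on Lipschitz subgraphs -/

/-- The closed subgraph of `g`. -/
def hypo (g : Torus d → ℝ) : Set (Cyl d) := {x | x.2 ≤ g x.1}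

@[simp] theorem mem_hypo {g : Torus d → ℝ} {x : Cyl d} : x ∈ hypo g ↔ x.2 ≤ g x.1 := Iff.rfl

/-- The flow consists of closed subgraphs, while density representatives are open ones; a graph is
null, so one may pass between the two. -/
theorem hypo_ae_eq_under {g : Torus d → ℝ} (hg : Continuous g) :
    hypo g =ᵐ[volume] under g := by
  filter_upwards [ae_ne_graph hg] with x hx
  exact propext ⟨fun h => lt_of_le_of_ne h hx, fun h => le_of_lt h⟩

theorem nullMeasurableSet_under {g : Torus d → ℝ} (hg : Continuous g) :
    NullMeasurableSet (under g) volume :=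
  (isOpen_under hg).measurableSet.nullMeasurableSet

theorem nullMeasurableSet_hypo {g : Torus d → ℝ} (hg : Continuous g) :
    NullMeasurableSet (hypo g) volume :=
  (nullMeasurableSet_under hg).congr (hypo_ae_eq_under hg).symm

theorem IsGeneralizedPerimeter.congr_ae {P : Set (Cyl d) → ℝ≥0∞} (hP : IsGeneralizedPerimeter P)
    {E F : Set (Cyl d)} (hE : NullMeasurableSet E volume) (hF : NullMeasurableSet F volume)
    (h : E =ᵐ[volume] F) : P E = P F :=
  hP.congr_null E F hE hF (measure_symmDiff_eq_zero_iff.2 h)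

theorem IsGeneralizedPerimeter.under_lt_top {P : Set (Cyl d) → ℝ≥0∞}
    (hP : IsGeneralizedPerimeter P) {L : ℝ} (hL : 0 < L) {g : Torus d → ℝ} (hg : TorusLip L g) :
    P (under g) < ∞ := by
  rw [hP.congr_ae (nullMeasurableSet_under hg.continuous) (nullMeasurableSet_hypo hg.continuous)
    (hypo_ae_eq_under hg.continuous).symm]
  exact hP.finite_of_lip L hL _ ⟨g, hg, rfl⟩

theorem abs_sd_under_le_of_mem_strip {R : ℝ} {g : Torus d → ℝ} (hg : ∀ x, |g x| ≤ R) :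
    ∀ x ∈ strip d R, |sd (under g) x| ≤ 1 + 2 * R := by
  intro x hx
  have h1 := abs_sd_under_le g x
  have h2 : |x.2 - g x.1| ≤ 2 * R := by
    have := abs_le.1 (hg x.1)
    rw [abs_le]; constructor <;> linarith [hx.1, hx.2]
  linarith

theorem integrableOn_sd_under {R : ℝ} {g : Torus d → ℝ} (hg : ∀ x, |g x| ≤ R) :
    IntegrableOn (sd (under g)) (strip d R) := by
  refine Measure.integrableOn_of_bounded (volume_strip_lt_top R).ne
    (continuous_sd _).aestronglyMeasurable (M := 1 + 2 * R) ?_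
  refine (ae_restrict_iff'₀ (nullMeasurableSet_strip R)).2 ?_
  exact Eventually.of_forall (abs_sd_under_le_of_mem_strip hg)

theorem under_le_of_volume_diff_eq_zero {g g' : Torus d → ℝ} (hg : Continuous g)
    (hg' : Continuous g') {s : ℝ} (h : volume (under g \ shift (0, s) (under g')) = 0)
    (x : Torus d) : g x ≤ g' x + s := by
  by_contra hlt
  rw [not_le] at hlt
  have hopen : IsOpen {y : Cyl d | g' y.1 + s < y.2 ∧ y.2 < g y.1} :=
    (isOpen_lt ((hg'.comp continuous_fst).add continuous_const) continuous_snd).inter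
      (isOpen_lt continuous_snd (hg.comp continuous_fst))
  obtain ⟨a, ha1, ha2⟩ := exists_between hlt
  refine (hopen.measure_pos volume ⟨(x, a), ha1, ha2⟩).ne' (measure_mono_null ?_ h)
  rintro y ⟨h1, h2⟩
  refine ⟨h2, ?_⟩
  simp only [mem_shift, mem_under, Prod.snd_sub, Prod.fst_sub, sub_zero, not_lt]
  linarith

theorem weightedEnergy_congr {P : Set (Cyl d) → ℝ≥0∞} (hP : IsGeneralizedPerimeter P) {R h : ℝ}
    {w : Cyl d → ℝ} {E F : Set (Cyl d)} (hE : NullMeasurableSet E volume)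
    (hF : NullMeasurableSet F volume) (hEF : E =ᵐ[volume] F) :
    weightedEnergy P R h w E = weightedEnergy P R h w F := by
  unfold weightedEnergy
  rw [hP.congr_ae hE hF hEF, setIntegral_congr_set (hEF.inter (ae_eq_refl (strip d R)))]

section Step

variable {P : Set (Cyl d) → ℝ≥0∞} {L R h : ℝ}

/-- For exact minimizers both errors vanish, and the gap `δ` between the data gives a positive gap
`δ / (1 + L)` between the weights, so the comparison inequality leaves no measure. -/
theorem volume_diff_shift_eq_zero (hP : IsGeneralizedPerimeter P) (hL : 0 ≤ L) (hh : 0 < h)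
    {g g' : Torus d → ℝ} (hg : TorusLip L g) (hgR : ∀ x, |g x| ≤ R)
    (hgR' : ∀ x, |g' x| ≤ R) {F F' : Set (Cyl d)}
    (hF : IsAlmostMin P R h (sd (under g)) 0 F) (hF' : IsAlmostMin P R h (sd (under g')) 0 F')
    {τ : Torus d} {s δ : ℝ} (hs : 0 < s) (hδ : 0 < δ) (hle : ∀ x, g x + δ ≤ g' (x - τ) + s) :
    volume (F \ shift (τ, s) F') = 0 := by
  have h1 := mul_volume_diff_shift_le hP hh (integrableOn_sd_under hgR)
    (integrableOn_sd_under hgR') hF hF' (v := (τ, s)) hs (ρ := δ / (1 + L)) fun x => by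
      rw [sd_sub]; exact sd_under_add_le hL hδ.le hg hle x
  rw [add_zero, mul_zero] at h1
  have h2 : volume.real (F \ shift (τ, s) F') = 0 :=
    le_antisymm (nonpos_of_mul_nonpos_right h1 (by positivity)) measureReal_nonneg
  refine (measureReal_eq_zero_iff ?_).1 h2
  refine ne_top_of_le_ne_top ?_ (measure_mono
    (t := {x : Cyl d | 0 + -R ≤ x.2 ∧ x.2 < 0 + R}) ?_)
  · rw [volume_Ico_graph (g := fun _ => 0) continuous_const]; exact ENNReal.ofReal_ne_top
  · rintro x ⟨hx1, hx2⟩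
    have h3 := hF.1.2.2 hx1
    have h4 : ¬ x.2 - s < -R := fun h => hx2 (hF'.1.2.1 (by simpa using h))
    simp only [Set.mem_ofPred_eq] at h3
    exact ⟨by linarith, by linarith⟩

/-- Minimizers for the signed distance from a Lipschitz subgraph are Lipschitz subgraphs. -/
theorem IsAlmostMin.exists_under (hP : IsGeneralizedPerimeter P) (hL : 0 ≤ L) (hh : 0 < h)
    {g : Torus d → ℝ} (hg : TorusLip L g) (hgR : ∀ x, |g x| ≤ R) {F : Set (Cyl d)}
    (hF : IsAlmostMin P R h (sd (under g)) 0 F) :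
    ∃ g₁ : Torus d → ℝ, TorusLip L g₁ ∧ (∀ x, |g₁ x| ≤ R) ∧ F =ᵐ[volume] under g₁ ∧
      IsAlmostMin P R h (sd (under g)) 0 (under g₁) := by
  obtain ⟨g₁, h1, h2, h3⟩ := exists_under_of_cone hL hF.1 fun τ s hs => by
    -- The minimizer is compared with its own translate; `δ` is what the Lipschitz bound leaves of
    -- the vertical shift `s`.
    refine volume_diff_shift_eq_zero hP hL hh hg hgR hgR hF hF (δ := s - L * torusDist τ 0)
      ((mul_nonneg hL (torusDist_nonneg τ 0)).trans_lt hs) (by linarith) fun x => ?_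
    have e1 := (le_abs_self _).trans (hg x (x - τ))
    have e2 : torusDist x (x - τ) = torusDist τ 0 := by
      rw [← torusDist_sub_right x (x - τ) (x - τ)]; simp
    rw [e2] at e1
    linarith
  have hm := nullMeasurableSet_under h1.continuous
  refine ⟨g₁, h1, h2, h3, isBetween_under h1 h2, ?_, fun G hG hPG => ?_⟩
  · rw [← hP.congr_ae hF.1.1 hm h3]; exact hF.2.1
  · rw [← weightedEnergy_congr hP hF.1.1 hm h3]; exact hF.2.2 G hG hPG

/-- The comparison principle: the step is monotone and commutes with vertical translations. -/
theorem le_add_of_isAlmostMin (hP : IsGeneralizedPerimeter P) (hL : 0 ≤ L) (hh : 0 < h)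
    {g g' g₁ g₁' : Torus d → ℝ} (hg : TorusLip L g)
    (hgR : ∀ x, |g x| ≤ R) (hgR' : ∀ x, |g' x| ≤ R) (hg₁ : Continuous g₁) (hg₁' : Continuous g₁')
    (hF : IsAlmostMin P R h (sd (under g)) 0 (under g₁))
    (hF' : IsAlmostMin P R h (sd (under g')) 0 (under g₁')) {ε : ℝ} (hε : 0 ≤ ε)
    (hle : ∀ x, g x ≤ g' x + ε) (x : Torus d) : g₁ x ≤ g₁' x + ε := by
  -- The comparison needs a strict gap, so an extra lift `δ` is added and then removed.
  refine le_of_forall_pos_le_add fun δ hδ => ?_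
  rw [add_assoc]
  refine under_le_of_volume_diff_eq_zero hg₁ hg₁' (volume_diff_shift_eq_zero hP hL hh hg hgR hgR'
    hF hF' (by linarith) hδ fun y => ?_) x
  rw [sub_zero]
  linarith [hle y]

theorem stepEnergy_eq {E F : Set (Cyl d)} (hF : P F < ∞) :
    stepEnergy P R h E F = (weightedEnergy P R h (sd (lebRep E)) F : EReal) := by
  unfold stepEnergy weightedEnergy
  rw [← EReal.coe_ennreal_toReal hF.ne, ← EReal.coe_add]
  rfl

theorem stepEnergy_eq_top {E F : Set (Cyl d)} (hF : ¬ P F < ∞) : stepEnergy P R h E F = ⊤ := by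
  rw [stepEnergy, not_lt_top_iff.1 hF, EReal.coe_ennreal_top, EReal.top_add_coe]

/-- One step of the scheme maps Lipschitz subgraphs to Lipschitz subgraphs. -/
theorem exists_stepSet_eq (hP : IsGeneralizedPerimeter P) (hL : 0 < L) (hR : 0 < R) (hh : 0 < h)
    {g : Torus d → ℝ} (hg : TorusLip L g) (hgR : ∀ x, |g x| ≤ R) :
    ∃ g₁ : Torus d → ℝ, TorusLip L g₁ ∧ (∀ x, |g₁ x| ≤ R) ∧
      IsAlmostMin P R h (sd (under g)) 0 (under g₁) ∧
      ∀ E, lebRep E = under g → stepSet P R h E = under g₁ := by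
  obtain ⟨F, hF⟩ := exists_isAlmostMin_zero hP hh (integrableOn_sd_under hgR)
    (abs_sd_under_le_of_mem_strip hgR) (c := 1 / (1 + L)) (by positivity)
    (fun s hs x => by
      rw [sd_sub]
      have := sd_under_add_le (g' := fun y => g (y - 0) + s) hL.le hs.le hg (fun y => by simp) x
      rwa [div_eq_inv_mul, ← one_div] at this)
    ⟨under fun _ => 0, isBetween_under (L := L) (fun x y => by
        simpa using mul_nonneg hL.le (torusDist_nonneg x y)) (fun x => by simpa using hR.le),
      hP.under_lt_top hL (fun x y => by simpa using mul_nonneg hL.le (torusDist_nonneg x y))⟩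
  obtain ⟨g₁, hg₁, hg₁R, -, hmin⟩ := hF.exists_under hP hL.le hh hg hgR
  refine ⟨g₁, hg₁, hg₁R, hmin, fun E hE => ?_⟩
  -- Two minimizers for the same datum compare both ways without gap, so the smallest and the
  -- largest coincide and `Classical.epsilon` has no choice.
  have huniq : ∀ G, IsStepMinimizer P R h E G → G = under g₁ := by
    rintro G ⟨hG1, hG2, hG3⟩
    have hPG : P G < ∞ := by
      by_contra hc
      have h1 := hG3 _ hmin.1
      rw [stepEnergy_eq hmin.2.1, stepEnergy_eq_top hc] at h1
      exact EReal.coe_ne_top _ (top_le_iff.1 h1)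
    have hGm : IsAlmostMin P R h (sd (under g)) 0 G := by
      refine ⟨hG1, hPG, fun G' h1 h2 => ?_⟩
      have h3 := hG3 G' h1
      rw [stepEnergy_eq hPG, stepEnergy_eq h2, EReal.coe_le_coe_iff, hE] at h3
      linarith
    obtain ⟨g₂, hg₂, hg₂R, hG₂, hm₂⟩ := hGm.exists_under hP hL.le hh hg hgR
    have : g₂ = g₁ := by
      funext x
      have k1 := le_add_of_isAlmostMin hP hL.le hh hg hgR hgR hg₂.continuous hg₁.continuous
        hm₂ hmin le_rfl (fun x => by simp) x
      have k2 := le_add_of_isAlmostMin hP hL.le hh hg hgR hgR hg₁.continuous hg₂.continuous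
        hmin hm₂ le_rfl (fun x => by simp) x
      linarith
    rw [← hG2, lebRep_congr hG₂, lebRep_under hL.le hg₂, this]
  have hself : IsStepMinimizer P R h E (under g₁) := by
    refine ⟨hmin.1, lebRep_under hL.le hg₁, fun G hG => ?_⟩
    by_cases hPG : P G < ∞
    · rw [stepEnergy_eq hmin.2.1, stepEnergy_eq hPG, EReal.coe_le_coe_iff, hE]
      simpa using hmin.2.2 G hG hPG
    · rw [stepEnergy_eq_top hPG]
      exact le_top
  have hspec := Classical.epsilon_spec
    (p := fun F => IsMinimalStep P R h E F ∧ IsMaximalStep P R h E F)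
    ⟨under g₁, ⟨hself, fun G hG => (huniq G hG).ge⟩, hself, fun G hG => (huniq G hG).le⟩
  exact huniq _ hspec.1.1

/-! ### Energy dissipation in one step -/

/-- The energy estimate for one step. -/
theorem sq_volume_symmDiff_le (hL : 0 ≤ L) (hh : 0 < h)
    {g g₁ : Torus d → ℝ} (hg : TorusLip L g) (hgR : ∀ x, |g x| ≤ R) (hg₁ : Continuous g₁)
    (hPg : P (under g) < ∞) (hmin : IsAlmostMin P R h (sd (under g)) 0 (under g₁)) :
    volume.real (under g₁ ∆ under g) ^ 2 ≤
      8 * (1 + L) * h * ((P (under g)).toReal - (P (under g₁)).toReal) := by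
  have hU := nullMeasurableSet_under hg.continuous
  have hU₁ := nullMeasurableSet_under hg₁
  have hw := integrableOn_sd_under hgR
  set S := strip d R with hS
  set U := under g with hUdef
  set U₁ := under g₁ with hU₁def
  -- Competitor: the previous set. The drop of perimeter controls the integral of `|sd U|` over the
  -- symmetric difference, divided by `h`.
  have hle := hmin.2.2 U (isBetween_under hg hgR) hPg
  rw [add_zero] at hle
  have hbet := isBetween_under hg hgR
  set T : Set (Cyl d) := (U₁ ∆ U) ∩ S with hT
  have hTS : T ⊆ S := Set.inter_subset_right
  have hTfin : volume T ≠ ∞ := ((measure_mono hTS).trans_lt (volume_strip_lt_top R)).ne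
  have hTm : NullMeasurableSet T volume := by
    have : NullMeasurableSet (U₁ ∆ U) volume := (hU₁.diff hU).union (hU.diff hU₁)
    exact this.inter (nullMeasurableSet_strip R)
  set m : ℝ := volume.real (U₁ ∆ U) with hm
  have hTm' : volume.real T = m := by
    refine measureReal_congr ?_
    filter_upwards [ae_ne_graph (d := d) (g := fun _ => -R) continuous_const] with x hx
    refine propext ⟨fun h => h.1, fun h => ⟨h, ?_⟩⟩
    have h1 : x.2 < R := by
      rcases h with h | h
      · exact hmin.1.2.2 h.1
      · exact hbet.2.2 h.1
    have h2 : ¬ x.2 < -R := fun hlt => by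
      rcases h with h | h
      · exact h.2 (hbet.2.1 hlt)
      · exact h.2 (hmin.1.2.1 hlt)
    exact ⟨lt_of_le_of_ne (not_lt.1 h2) hx.symm, h1⟩
  set f : Cyl d → ℝ := fun x => |x.2 - g x.1| / (1 + L) with hf
  have hfc : Continuous f :=
    (continuous_snd.sub (hg.continuous.comp continuous_fst)).abs.div_const _
  have hfi : IntegrableOn f S := by
    refine Integrable.mono' hw.norm hfc.aestronglyMeasurable (Eventually.of_forall fun x => ?_)
    rw [Real.norm_of_nonneg (by positivity : 0 ≤ f x), Real.norm_eq_abs]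
    by_cases hx : x ∈ under g
    · exact (sd_under_le hL hg hx).trans (neg_le_abs _)
    · exact (le_sd_under hL hg hx).trans (le_abs_self _)
  have e1 := integral_inter_add_sdiff₀ hU (hw.mono_set (Set.inter_subset_right (s := U₁)))
  have e2 := integral_inter_add_sdiff₀ hU₁ (hw.mono_set (Set.inter_subset_right (s := U)))
  have e3 := integral_inter_add_sdiff₀ hU (hfi.mono_set hTS)
  have s1 : U₁ ∩ S ∩ U = U ∩ S ∩ U₁ := by
    ext x; simp only [Set.mem_inter_iff]; tauto
  have s2 : T ∩ U = (U ∩ S) \ U₁ := by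
    ext x; simp only [hT, Set.mem_inter_iff, Set.mem_symmDiff, Set.mem_sdiff]; tauto
  have s3 : T \ U = (U₁ ∩ S) \ U := by
    ext x; simp only [hT, Set.mem_inter_iff, Set.mem_symmDiff, Set.mem_sdiff]; tauto
  rw [s1] at e1
  rw [s2, s3] at e3
  have hsubS : ∀ A B : Set (Cyl d), (A ∩ S) \ B ⊆ S := fun A B x hx => hx.1.2
  have hSm := nullMeasurableSet_strip (d := d) R
  have b1 : ∫ x in (U₁ ∩ S) \ U, f x ≤ ∫ x in (U₁ ∩ S) \ U, sd U x := by
    refine setIntegral_mono_on₀ (hfi.mono_set (hsubS _ _)) (hw.mono_set (hsubS _ _))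
      ((hU₁.inter hSm).diff hU) fun x hx => ?_
    exact le_sd_under hL hg hx.2
  have b2 : ∫ x in (U ∩ S) \ U₁, f x ≤ -∫ x in (U ∩ S) \ U₁, sd U x := by
    rw [← integral_neg]
    refine setIntegral_mono_on₀ (hfi.mono_set (hsubS _ _)) (hw.mono_set (hsubS _ _)).neg
      ((hU.inter hSm).diff hU₁) fun x hx => ?_
    exact sd_under_le hL hg hx.1.1
  -- This layer around the graph has measure `m / 2`, so at least half of the symmetric difference
  -- lies outside it, where `f ≥ m / (4 * (1 + L))`.
  set N : Set (Cyl d) := {x | |x.2 - g x.1| ≤ m / 4} with hN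
  have hm0 : 0 ≤ m := measureReal_nonneg
  have hNv : volume N = ENNReal.ofReal (2 * (m / 4)) := volume_Icc_graph hg.continuous _
  have hNr : volume.real N = m / 2 := by
    rw [Measure.real, hNv, ENNReal.toReal_ofReal (by positivity)]; ring
  have hNm : MeasurableSet N := measurableSet_le
    (continuous_snd.sub (hg.continuous.comp continuous_fst)).abs.measurable measurable_const
  have e4 := integral_inter_add_sdiff₀ hNm.nullMeasurableSet (hfi.mono_set hTS)
  have b3 : 0 ≤ ∫ x in T ∩ N, f x := integral_nonneg fun x => by positivity
  have b4 : m / 4 / (1 + L) * volume.real (T \ N) ≤ ∫ x in T \ N, f x := by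
    have : ∫ _x in T \ N, m / 4 / (1 + L) = m / 4 / (1 + L) * volume.real (T \ N) := by
      rw [setIntegral_const, smul_eq_mul, mul_comm]
    rw [← this]
    refine setIntegral_mono_on₀ (integrableOn_const
      (ne_top_of_le_ne_top hTfin (measure_mono Set.sdiff_subset)))
      (hfi.mono_set (Set.sdiff_subset.trans hTS)) (hTm.diff hNm.nullMeasurableSet) fun x hx => ?_
    have hx2 : ¬ |x.2 - g x.1| ≤ m / 4 := hx.2
    simp only [hf]
    gcongr
    exact (not_le.1 hx2).le
  have b5 : m / 2 ≤ volume.real (T \ N) := by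
    have h1 := le_measureReal_sdiff (μ := volume) (s₁ := T) (s₂ := N)
      (by rw [hNv]; exact ENNReal.ofReal_ne_top)
    rw [hTm', hNr] at h1
    linarith
  have b6 : m ^ 2 / (8 * (1 + L)) ≤ ∫ x in T, f x := by
    have h1 : m / 4 / (1 + L) * (m / 2) ≤ m / 4 / (1 + L) * volume.real (T \ N) := by gcongr
    have h2 : m ^ 2 / (8 * (1 + L)) = m / 4 / (1 + L) * (m / 2) := by field_simp; ring
    linarith
  have b7 : 1 / h * (m ^ 2 / (8 * (1 + L))) ≤ (P U).toReal - (P U₁).toReal := by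
    have h1 : m ^ 2 / (8 * (1 + L)) ≤ (∫ x in U₁ ∩ S, sd U x) - ∫ x in U ∩ S, sd U x := by
      linarith
    have h2 := mul_le_mul_of_nonneg_left h1 (by positivity : 0 ≤ 1 / h)
    unfold weightedEnergy at hle
    rw [mul_sub] at h2
    linarith
  have h3 : 1 / h * (m ^ 2 / (8 * (1 + L))) = m ^ 2 / (8 * (1 + L) * h) := by field_simp
  rw [h3, div_le_iff₀ (by positivity)] at b7
  linarith

end Step

/-! ### Area distance and uniform distance between graphs -/

/-- The measure of the region between the graphs of two functions. -/
noncomputable def areaDist (g g' : Torus d → ℝ) : ℝ := volume.real (under g ∆ under g')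

theorem areaDist_nonneg (g g' : Torus d → ℝ) : 0 ≤ areaDist g g' := measureReal_nonneg

theorem areaDist_comm (g g' : Torus d → ℝ) : areaDist g g' = areaDist g' g := by
  rw [areaDist, areaDist, symmDiff_comm]

theorem areaDist_self (g : Torus d → ℝ) : areaDist g g = 0 := by simp [areaDist]

theorem volume_symmDiff_under_lt_top {R : ℝ} {g g' : Torus d → ℝ} (hg : ∀ x, |g x| ≤ R)
    (hg' : ∀ x, |g' x| ≤ R) : volume (under g ∆ under g') < ∞ := by
  refine (measure_mono (t := {x : Cyl d | 0 + -R ≤ x.2 ∧ x.2 < 0 + R}) ?_).trans_lt ?_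
  · intro x hx
    have h1 := abs_le.1 (hg x.1)
    have h2 := abs_le.1 (hg' x.1)
    simp only [Set.mem_symmDiff, mem_under, not_lt] at hx
    rcases hx with h | h
    · exact ⟨by linarith [h.2], by linarith [h.1]⟩
    · exact ⟨by linarith [h.2], by linarith [h.1]⟩
  · rw [volume_Ico_graph (g := fun _ => 0) continuous_const]; exact ENNReal.ofReal_lt_top

theorem areaDist_triangle {R : ℝ} {g₁ g₂ g₃ : Torus d → ℝ} (h₁ : ∀ x, |g₁ x| ≤ R)
    (h₂ : ∀ x, |g₂ x| ≤ R) (h₃ : ∀ x, |g₃ x| ≤ R) :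
    areaDist g₁ g₃ ≤ areaDist g₁ g₂ + areaDist g₂ g₃ := by
  have f₁ := (volume_symmDiff_under_lt_top h₁ h₂).ne
  have f₂ := (volume_symmDiff_under_lt_top h₂ h₃).ne
  unfold areaDist Measure.real
  rw [← ENNReal.toReal_add f₁ f₂]
  exact ENNReal.toReal_mono (ENNReal.add_ne_top.2 ⟨f₁, f₂⟩) (measure_symmDiff_le _ _ _)

theorem areaDist_le {g g' : Torus d → ℝ} (hg : Continuous g) {ε : ℝ}
    (h : ∀ x, |g x - g' x| ≤ ε) : areaDist g g' ≤ 2 * ε := by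
  have hε : 0 ≤ ε := (abs_nonneg _).trans (h 0)
  refine ENNReal.toReal_le_of_le_ofReal (by positivity) ?_
  rw [← volume_Icc_graph hg ε]
  refine measure_mono fun x hx => ?_
  have h1 := abs_le.1 (h x.1)
  simp only [Set.mem_symmDiff, mem_under, not_lt] at hx
  change |x.2 - g x.1| ≤ ε
  rw [abs_le]
  rcases hx with h | h
  · constructor <;> linarith [h.1, h.2]
  · constructor <;> linarith [h.1, h.2]

/-- For equi-Lipschitz functions, closeness in measure implies uniform closeness. -/
theorem exists_abs_sub_le_of_areaDist_lt (d : ℕ) {L : ℝ} (hL : 0 ≤ L) (R : ℝ) {ε : ℝ} (hε : 0 < ε) :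
    ∃ η > 0, ∀ g g' : Torus d → ℝ, TorusLip L g → TorusLip L g' → (∀ x, |g x| ≤ R) →
      (∀ x, |g' x| ≤ R) → areaDist g g' < η → ∀ x, |g x - g' x| ≤ ε := by
  -- Over a torus ball of radius `r` both functions vary by at most `ε / 4`. A gap larger than `ε`
  -- at the centre leaves room between the graphs for a translate of the box `W`, of height `ε / 2`.
  set r : ℝ := ε / (4 * (1 + L)) with hr
  have hr0 : 0 < r := by positivity
  have hLr : L * r ≤ ε / 4 := by
    rw [hr, mul_div_assoc', div_le_div_iff₀ (by positivity) (by positivity)]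
    nlinarith
  set W : Set (Cyl d) := {z | torusDist z.1 0 < r ∧ z.2 ∈ Set.Ioo 0 (ε / 2)} with hW
  have hWo : IsOpen W := (isOpen_lt ((continuous_torusDist_left 0).comp continuous_fst)
    continuous_const).inter (isOpen_Ioo.preimage continuous_snd)
  have hWpos : 0 < volume W := hWo.measure_pos _
    ⟨(0, ε / 4), by simpa [torusDist_self] using hr0, by constructor <;> linarith⟩
  have hWm := hWo.measurableSet.nullMeasurableSet (μ := (volume : Measure (Cyl d)))
  have hWfin : volume W ≠ ∞ := by
    refine ne_top_of_le_ne_top ?_ (measure_mono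
      (t := {x : Cyl d | 0 + 0 ≤ x.2 ∧ x.2 < 0 + ε / 2}) ?_)
    · rw [volume_Ico_graph (g := fun _ => 0) continuous_const]; exact ENNReal.ofReal_ne_top
    · rintro x ⟨-, h1, h2⟩; exact ⟨by linarith, by linarith⟩
  have key : ∀ g g' : Torus d → ℝ, TorusLip L g → TorusLip L g' → (∀ x, |g x| ≤ R) →
      (∀ x, |g' x| ≤ R) → areaDist g g' < volume.real W → ∀ x, g' x - g x ≤ ε := by
    intro g g' hg hg' hgR hgR' hlt x
    by_contra hc
    refine hlt.not_ge ?_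
    unfold areaDist Measure.real
    refine ENNReal.toReal_mono (volume_symmDiff_under_lt_top hgR hgR').ne ?_
    rw [← volume_shift (v := (x, g x + ε / 4)) hWm]
    refine measure_mono fun z hz => Or.inr ?_
    have h1 : torusDist z.1 x < r := by
      have := hz.1
      rwa [Prod.fst_sub, ← torusDist_sub_right _ _ (-x), sub_neg_eq_add, sub_neg_eq_add,
        sub_add_cancel, zero_add] at this
    have h2 : 0 < z.2 - (g x + ε / 4) ∧ z.2 - (g x + ε / 4) < ε / 2 := hz.2
    have h3 : L * torusDist z.1 x ≤ ε / 4 :=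
      (mul_le_mul_of_nonneg_left h1.le hL).trans hLr
    have h4 := abs_le.1 ((hg z.1 x).trans h3)
    have h5 := abs_le.1 ((hg' z.1 x).trans h3)
    refine ⟨?_, ?_⟩
    · simp only [mem_under]; linarith
    · simp only [mem_under, not_lt]; linarith
  refine ⟨volume.real W, ENNReal.toReal_pos hWpos.ne' hWfin, ?_⟩
  intro g g' hg hg' hgR hgR' hlt x
  rw [abs_le]
  have k1 := key g g' hg hg' hgR hgR' hlt x
  have k2 := key g' g hg' hg hgR' hgR (by rwa [areaDist_comm]) x
  constructor <;> linarith

/-! ### The discrete flow of graphs and its estimates -/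

/-- The discrete evolution at the level of graphs. -/
structure IsGraphFlow (P : Set (Cyl d) → ℝ≥0∞) (L R h : ℝ) (u : ℕ → Torus d → ℝ) : Prop where
  lip : ∀ k, TorusLip L (u k)
  bdd : ∀ k x, |u k x| ≤ R
  min : ∀ k, IsAlmostMin P R h (sd (under (u k))) 0 (under (u (k + 1)))

section GraphFlow

variable {P : Set (Cyl d) → ℝ≥0∞} {L R h : ℝ}

theorem exists_isGraphFlow (hP : IsGeneralizedPerimeter P) (hL : 0 < L) (hR : 0 < R) (hh : 0 < h)
    {g : Torus d → ℝ} (hg : TorusLip L g) (hgR : ∀ x, |g x| ≤ R) :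
    ∃ u : ℕ → Torus d → ℝ, IsGraphFlow P L R h u ∧ u 0 = g ∧
      ∀ k, discreteFlow P R h (hypo g) k =ᵐ[volume] under (u k) := by
  choose next hlip hbdd hmin hstep using fun v : {v : Torus d → ℝ // TorusLip L v ∧ ∀ x, |v x| ≤ R} =>
    exists_stepSet_eq hP hL hR hh v.2.1 v.2.2
  set U : ℕ → {v : Torus d → ℝ // TorusLip L v ∧ ∀ x, |v x| ≤ R} := fun k =>
    (fun v => ⟨next v, hlip v, hbdd v⟩)^[k] ⟨g, hg, hgR⟩ with hU
  have hsucc : ∀ k, (U (k + 1)).1 = next (U k) := fun k => by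
    simp only [hU, Function.iterate_succ_apply']
  have hae : ∀ k, discreteFlow P R h (hypo g) k =ᵐ[volume] under (U k).1 := by
    intro k
    induction k with
    | zero => exact hypo_ae_eq_under hg.continuous
    | succ k ih =>
      -- The step sees its datum only through the Lebesgue representative, so the closed initial set
      -- and the open later ones are treated alike.
      have := hstep (U k) (discreteFlow P R h (hypo g) k)
        ((lebRep_congr ih).trans (lebRep_under hL.le (U k).2.1))
      rw [discreteFlow, this, hsucc]
      exact ae_eq_refl _
  refine ⟨fun k => (U k).1, ⟨fun k => (U k).2.1, fun k => (U k).2.2, fun k => ?_⟩, rfl, hae⟩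
  rw [hsucc]
  exact hmin (U k)

variable {u v : ℕ → Torus d → ℝ}

theorem IsGraphFlow.tail (hu : IsGraphFlow P L R h u) (a : ℕ) :
    IsGraphFlow P L R h fun k => u (a + k) :=
  ⟨fun _ => hu.lip _, fun _ => hu.bdd _, fun _ => hu.min _⟩

/-- Non-expansiveness in the sup norm: the comparison principle with the constant `ε`, applied in
both directions at each step. -/
theorem IsGraphFlow.abs_sub_le (hP : IsGeneralizedPerimeter P) (hL : 0 ≤ L) (hh : 0 < h)
    (hu : IsGraphFlow P L R h u) (hv : IsGraphFlow P L R h v) {ε : ℝ}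
    (h0 : ∀ x, |u 0 x - v 0 x| ≤ ε) (k : ℕ) : ∀ x, |u k x - v k x| ≤ ε := by
  have hε : 0 ≤ ε := (abs_nonneg _).trans (h0 0)
  induction k with
  | zero => exact h0
  | succ k ih =>
    intro x
    have k1 := le_add_of_isAlmostMin hP hL hh (hu.lip k) (hu.bdd k) (hv.bdd k)
      (hu.lip _).continuous (hv.lip _).continuous (hu.min k) (hv.min k) hε
      (fun x => by linarith [(abs_le.1 (ih x)).2]) x
    have k2 := le_add_of_isAlmostMin hP hL hh (hv.lip k) (hv.bdd k) (hu.bdd k)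
      (hv.lip _).continuous (hu.lip _).continuous (hv.min k) (hu.min k) hε
      (fun x => by linarith [(abs_le.1 (ih x)).1]) x
    rw [abs_le]
    constructor <;> linarith

theorem IsGraphFlow.sq_areaDist_succ_le (hP : IsGeneralizedPerimeter P) (hL : 0 < L) (hh : 0 < h)
    (hu : IsGraphFlow P L R h u) (k : ℕ) : areaDist (u (k + 1)) (u k) ^ 2 ≤
      8 * (1 + L) * h * ((P (under (u k))).toReal - (P (under (u (k + 1)))).toReal) :=
  sq_volume_symmDiff_le hL.le hh (hu.lip k) (hu.bdd k) (hu.lip _).continuous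
    (hP.under_lt_top hL (hu.lip k)) (hu.min k)

theorem IsGraphFlow.antitone_perimeter (hP : IsGeneralizedPerimeter P) (hL : 0 < L) (hh : 0 < h)
    (hu : IsGraphFlow P L R h u) : Antitone fun k => P (under (u k)) := by
  refine antitone_nat_of_succ_le fun k => ?_
  rw [← ENNReal.toReal_le_toReal (hP.under_lt_top hL (hu.lip _)).ne
    (hP.under_lt_top hL (hu.lip _)).ne]
  have h1 := (sq_nonneg _).trans (hu.sq_areaDist_succ_le hP hL hh k)
  have h2 := nonneg_of_mul_nonneg_right h1 (by positivity)
  linarith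

/-- The discrete Hölder estimate. -/
theorem IsGraphFlow.areaDist_le_sqrt (hP : IsGeneralizedPerimeter P) (hL : 0 < L) (hh : 0 < h)
    (hu : IsGraphFlow P L R h u) {a b : ℕ} (hab : a ≤ b) {τ : ℝ} (hτ : (b - a : ℝ) * h ≤ τ) :
    areaDist (u b) (u a) ≤ √(8 * (1 + L) * (P (under (u 0))).toReal) * √τ := by
  obtain ⟨n, rfl⟩ := Nat.exists_eq_add_of_le hab
  have h1 : areaDist (u (a + n)) (u a) ≤
      ∑ i ∈ Finset.range n, areaDist (u (a + i + 1)) (u (a + i)) := by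
    clear hτ hab
    induction n with
    | zero => simp [areaDist_self]
    | succ n ih =>
      rw [Finset.sum_range_succ]
      have := areaDist_triangle (hu.bdd (a + (n + 1))) (hu.bdd (a + n)) (hu.bdd a)
      rw [← add_assoc] at this ⊢
      linarith
  have h2 : ∑ i ∈ Finset.range n, areaDist (u (a + i + 1)) (u (a + i)) ^ 2 ≤
      8 * (1 + L) * h * (P (under (u 0))).toReal := by
    have e1 : ∑ i ∈ Finset.range n, areaDist (u (a + i + 1)) (u (a + i)) ^ 2 ≤
        ∑ i ∈ Finset.range n, 8 * (1 + L) * h *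
          ((P (under (u (a + i)))).toReal - (P (under (u (a + (i + 1))))).toReal) :=
      Finset.sum_le_sum fun i _ => hu.sq_areaDist_succ_le hP hL hh (a + i)
    rw [← Finset.mul_sum,
      Finset.sum_range_sub' (f := fun i => (P (under (u (a + i)))).toReal)] at e1
    refine e1.trans (mul_le_mul_of_nonneg_left ?_ (by positivity))
    have e2 : (P (under (u (a + 0)))).toReal ≤ (P (under (u 0))).toReal :=
      ENNReal.toReal_mono (hP.under_lt_top hL (hu.lip 0)).ne
        (hu.antitone_perimeter hP hL hh (Nat.zero_le _))
    have e3 : 0 ≤ (P (under (u (a + n)))).toReal := ENNReal.toReal_nonneg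
    linarith
  -- Cauchy–Schwarz over the `n` steps: the number of steps times `h` becomes the elapsed time.
  have h3 := sq_sum_le_card_mul_sum_sq (s := Finset.range n)
    (f := fun i => areaDist (u (a + i + 1)) (u (a + i)))
  rw [Finset.card_range] at h3
  rw [← Real.sqrt_mul (by positivity)]
  refine h1.trans (Real.le_sqrt_of_sq_le (h3.trans ?_))
  push_cast at hτ
  rw [add_sub_cancel_left] at hτ
  calc (n : ℝ) * ∑ i ∈ Finset.range n, areaDist (u (a + i + 1)) (u (a + i)) ^ 2
      ≤ n * (8 * (1 + L) * h * (P (under (u 0))).toReal) := by gcongr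
    _ = 8 * (1 + L) * (P (under (u 0))).toReal * (n * h) := by ring
    _ ≤ _ := by gcongr

/-- The Hölder estimate for the piecewise constant interpolation. -/
theorem IsGraphFlow.areaDist_floor_le (hP : IsGeneralizedPerimeter P) (hL : 0 < L) (hh : 0 < h)
    (hu : IsGraphFlow P L R h u) {s t : ℝ} (hs : 0 ≤ s) (ht : 0 ≤ t) :
    areaDist (u ⌊t / h⌋₊) (u ⌊s / h⌋₊) ≤
      √(8 * (1 + L) * (P (under (u 0))).toReal) * √(|t - s| + h) := by
  wlog hst : s ≤ t generalizing s t
  · rw [areaDist_comm, abs_sub_comm]; exact this ht hs (le_of_not_ge hst)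
  refine hu.areaDist_le_sqrt hP hL hh (Nat.floor_mono (by gcongr)) ?_
  -- Rounding to the time grid can cost one additional step, whence the summand `h`.
  have h1 : (⌊t / h⌋₊ : ℝ) ≤ t / h := Nat.floor_le (by positivity)
  have h2 : s / h < ⌊s / h⌋₊ + 1 := Nat.lt_floor_add_one _
  rw [le_div_iff₀ hh] at h1
  rw [div_lt_iff₀ hh] at h2
  rw [abs_of_nonneg (by linarith)]
  linarith

end GraphFlow

/-! ### Compactness of curves of Lipschitz functions -/

/-- The `L`-Lipschitz functions bounded by `R`, as a set of continuous functions. -/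
def lipClass (d : ℕ) (L R : ℝ) : Set C(Torus d, ℝ) := {u | TorusLip L u ∧ ∀ x, |u x| ≤ R}

/-- Arzelà–Ascoli: the class is pointwise closed in a product of compact intervals, and
equicontinuous through the common constant `L`. -/
theorem isCompact_lipClass (d : ℕ) (L R : ℝ) : IsCompact (lipClass d L R) := by
  apply ArzelaAscoli.isCompact_of_equicontinuous
  · have himg : ContinuousMap.toFun '' lipClass d L R =
        {f : Torus d → ℝ | TorusLip L f} ∩ Set.pi Set.univ fun _ => Set.Icc (-R) R := by
      ext f
      constructor
      · rintro ⟨u, hu, rfl⟩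
        exact ⟨hu.1, fun x _ => abs_le.1 (hu.2 x)⟩
      · rintro ⟨h1, h2⟩
        exact ⟨⟨f, h1.continuous⟩, ⟨h1, fun x => abs_le.2 (h2 x trivial)⟩, rfl⟩
    rw [himg]
    refine IsCompact.inter_left (isCompact_univ_pi fun _ => isCompact_Icc) ?_
    simp only [TorusLip, Set.ofPred_forall]
    exact isClosed_iInter fun x => isClosed_iInter fun y =>
      isClosed_le ((continuous_apply x).sub (continuous_apply y)).abs continuous_const
  · intro x
    rw [Metric.equicontinuousAt_iff_right]
    intro ε hε
    have h2 : Tendsto (fun y => L * torusDist y x) (𝓝 x) (𝓝 (L * torusDist x x)) :=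
      ((continuous_torusDist_left x).const_smul L).tendsto x
    rw [torusDist_self, mul_zero] at h2
    filter_upwards [h2.eventually (gt_mem_nhds hε)] with y hy u
    rw [Real.dist_eq, abs_sub_comm]
    exact (u.2.1 y x).trans_lt hy

/-- A compactness theorem for asymptotically equicontinuous sequences of curves. -/
theorem exists_subseq_tendsto_curve {X : Type*} [MetricSpace X] {K : Set X} (hK : IsCompact K)
    {f : ℕ → ℝ → X} (hf : ∀ n t, f n t ∈ K)
    (hequi : ∀ ε > 0, ∃ δ > 0, ∀ᶠ n in atTop, ∀ s t : ℝ, 0 ≤ s → 0 ≤ t → |t - s| < δ →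
      dist (f n t) (f n s) ≤ ε) :
    ∃ φ : ℕ → ℕ, StrictMono φ ∧ ∃ F : ℝ → X, ∀ t, 0 ≤ t →
      F t ∈ K ∧ Tendsto (fun k => f (φ k) t) atTop (𝓝 (F t)) := by
  -- The diagonal extraction is sequential compactness of a countable product; `|q|` keeps all
  -- sampled times nonnegative.
  have hcomp : IsCompact (Set.pi Set.univ fun _ : ℚ => K) := isCompact_univ_pi fun _ => hK
  obtain ⟨y, -, φ, hφ, hlim⟩ := hcomp.tendsto_subseq
    (x := fun n (q : ℚ) => f n |(q : ℝ)|) fun n q _ => hf n _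
  refine ⟨φ, hφ, ?_⟩
  have hex : ∀ t : ℝ, ∃ z, 0 ≤ t → z ∈ K ∧ Tendsto (fun k => f (φ k) t) atTop (𝓝 z) := by
    intro t
    by_cases ht : 0 ≤ t
    swap
    · exact ⟨f 0 0, fun h => absurd h ht⟩
    have hC : CauchySeq fun k => f (φ k) t := by
      rw [Metric.cauchySeq_iff']
      intro ε hε
      obtain ⟨δ, hδ, hev⟩ := hequi (ε / 4) (by positivity)
      -- Convergence at a rational time slightly after `t` is carried over to `t` by the asymptotic
      -- equicontinuity.
      obtain ⟨q, hq1, hq2⟩ := exists_rat_btwn (show t < t + δ by linarith)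
      have hq0 : (0 : ℝ) ≤ q := ht.trans hq1.le
      have hyq := tendsto_pi_nhds.1 hlim q
      simp only [Function.comp_def, abs_of_nonneg hq0] at hyq
      obtain ⟨N₁, hN₁⟩ := Metric.cauchySeq_iff'.1 hyq.cauchySeq (ε / 4) (by positivity)
      obtain ⟨N₂, hN₂⟩ := eventually_atTop.1 (hφ.tendsto_atTop.eventually hev)
      refine ⟨max N₁ N₂, fun n hn => ?_⟩
      have a1 := hN₂ n ((le_max_right _ _).trans hn) q t hq0 ht (by
        rw [abs_lt]; constructor <;> linarith)
      have a2 := hN₂ (max N₁ N₂) (le_max_right _ _) q t hq0 ht (by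
        rw [abs_lt]; constructor <;> linarith)
      have a3 := hN₁ n ((le_max_left _ _).trans hn)
      have a4 := hN₁ (max N₁ N₂) (le_max_left _ _)
      have b1 := dist_triangle4 (f (φ n) t) (f (φ n) q) (f (φ N₁) q) (f (φ (max N₁ N₂)) t)
      have b2 := dist_triangle (f (φ N₁) q) (f (φ (max N₁ N₂)) q) (f (φ (max N₁ N₂)) t)
      rw [dist_comm] at a2 a4
      linarith
    obtain ⟨z, hz, hlz⟩ := cauchySeq_tendsto_of_isComplete hK.isComplete (fun k => hf _ t) hC
    exact ⟨z, fun _ => ⟨hz, hlz⟩⟩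
  choose F hF using hex
  exact ⟨F, fun t ht => hF t ht⟩

/-! ### Uniqueness of limits, restarted flows and passage to the limit -/

theorem volume_symmDiff_eq_ofReal {R : ℝ} {g g' : Torus d → ℝ} (hg : ∀ x, |g x| ≤ R)
    (hg' : ∀ x, |g' x| ≤ R) {E F : Set (Cyl d)} (hE : E =ᵐ[volume] under g)
    (hF : F =ᵐ[volume] under g') : volume (E ∆ F) = ENNReal.ofReal (areaDist g g') := by
  rw [areaDist, Measure.real, ENNReal.ofReal_toReal (volume_symmDiff_under_lt_top hg hg').ne]
  exact measure_congr (hE.symmDiff hF)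

theorem eq_of_hypo_ae_eq {g g' : Torus d → ℝ} (hg : Continuous g) (hg' : Continuous g')
    (h : hypo g =ᵐ[volume] hypo g') : g = g' := by
  have h1 : under g =ᵐ[volume] under g' :=
    (hypo_ae_eq_under hg).symm.trans (h.trans (hypo_ae_eq_under hg'))
  have hs : ∀ A : Set (Cyl d), shift (0, 0) A = A := fun A => by
    ext x
    change x - 0 ∈ A ↔ x ∈ A
    rw [sub_zero]
  funext x
  have k1 := under_le_of_volume_diff_eq_zero hg hg' (s := 0)
    (by rw [hs]; exact ae_le_set.1 h1.le) x
  have k2 := under_le_of_volume_diff_eq_zero hg' hg (s := 0)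
    (by rw [hs]; exact ae_le_set.1 h1.symm.le) x
  linarith

theorem eq_zero_of_tendsto_symmDiff {A : ℕ → Set (Cyl d)} {E F : Set (Cyl d)}
    (hE : Tendsto (fun k => volume (A k ∆ E)) atTop (𝓝 0))
    (hF : Tendsto (fun k => volume (A k ∆ F)) atTop (𝓝 0)) : volume (E ∆ F) = 0 := by
  have h1 := hE.add hF
  rw [add_zero] at h1
  refine le_antisymm (ge_of_tendsto' h1 fun k => ?_) zero_le
  rw [symmDiff_comm (A k) E]
  exact measure_symmDiff_le _ _ _

/-- Convergence of the restarted approximate flows, by the comparison principle. -/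
theorem tendsto_approxFlow_restart {P : Set (Cyl d) → ℝ≥0∞} (hP : IsGeneralizedPerimeter P)
    {L R : ℝ} (hL : 0 < L) {h : ℕ → ℝ} (hh : ∀ n, 0 < h n) (hh0 : Tendsto h atTop (𝓝 0))
    {u v : ℕ → ℕ → Torus d → ℝ} (hu : ∀ n, IsGraphFlow P L R (h n) (u n))
    (hv : ∀ n, IsGraphFlow P L R (h n) (v n)) {p : ℝ≥0∞} (hup : ∀ n, P (under (u n 0)) = p)
    {r s : ℝ} (hr : 0 ≤ r) (hs : 0 ≤ s) {ε ε' : ℕ → ℝ} (hε : Tendsto ε atTop (𝓝 0))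
    (hε' : Tendsto ε' atTop (𝓝 0)) {g : Torus d → ℝ} (hgR : ∀ x, |g x| ≤ R)
    (h₁ : ∀ n x, |v n 0 x - u n ⌊r / h n⌋₊ x| ≤ ε n)
    (h₂ : ∀ n x, |u n ⌊(r + s) / h n⌋₊ x - g x| ≤ ε' n) :
    Tendsto (fun n => areaDist (v n ⌊s / h n⌋₊) g) atTop (𝓝 0) := by
  have hlim : Tendsto (fun n => 2 * ε n + √(8 * (1 + L) * p.toReal) * √(h n) + 2 * ε' n) atTop
      (𝓝 0) := by
    have e1 := (Real.continuous_sqrt.tendsto 0).comp hh0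
    rw [Real.sqrt_zero] at e1
    have := ((hε.const_mul 2).add (e1.const_mul √(8 * (1 + L) * p.toReal))).add (hε'.const_mul 2)
    simpa using this
  refine squeeze_zero (fun n => areaDist_nonneg _ _) (fun n => ?_) hlim
  have ha : (⌊r / h n⌋₊ : ℝ) ≤ r / h n := Nat.floor_le (div_nonneg hr (hh n).le)
  have hb : (⌊s / h n⌋₊ : ℝ) ≤ s / h n := Nat.floor_le (div_nonneg hs (hh n).le)
  have ha' := Nat.lt_floor_add_one (r / h n)
  have hb' := Nat.lt_floor_add_one (s / h n)
  -- The two step counts differ by at most one, and one step moves the graph by an area of order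
  -- `√(h n)`.
  have hle : ⌊r / h n⌋₊ + ⌊s / h n⌋₊ ≤ ⌊(r + s) / h n⌋₊ := by
    refine Nat.le_floor ?_
    rw [add_div]; push_cast; linarith
  have hle' : ⌊(r + s) / h n⌋₊ ≤ ⌊r / h n⌋₊ + ⌊s / h n⌋₊ + 1 := by
    refine Nat.lt_succ_iff.1 ((Nat.floor_lt (div_nonneg (add_nonneg hr hs) (hh n).le)).2 ?_)
    rw [add_div]; push_cast; linarith
  have t1 : areaDist (v n ⌊s / h n⌋₊) (u n (⌊r / h n⌋₊ + ⌊s / h n⌋₊)) ≤ 2 * ε n :=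
    areaDist_le ((hv n).lip _).continuous
      ((hv n).abs_sub_le hP hL.le (hh n) ((hu n).tail ⌊r / h n⌋₊) (h₁ n) ⌊s / h n⌋₊)
  have t2 : areaDist (u n ⌊(r + s) / h n⌋₊) (u n (⌊r / h n⌋₊ + ⌊s / h n⌋₊)) ≤
      √(8 * (1 + L) * p.toReal) * √(h n) := by
    rw [← hup n]
    refine (hu n).areaDist_le_sqrt hP hL (hh n) hle ?_
    have : (⌊(r + s) / h n⌋₊ : ℝ) ≤ ⌊r / h n⌋₊ + ⌊s / h n⌋₊ + 1 := by exact_mod_cast hle'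
    push_cast
    nlinarith [hh n]
  have t3 : areaDist (u n ⌊(r + s) / h n⌋₊) g ≤ 2 * ε' n :=
    areaDist_le ((hu n).lip _).continuous (h₂ n)
  have q1 := areaDist_triangle ((hv n).bdd ⌊s / h n⌋₊) ((hu n).bdd (⌊r / h n⌋₊ + ⌊s / h n⌋₊)) hgR
  have q2 := areaDist_triangle ((hu n).bdd (⌊r / h n⌋₊ + ⌊s / h n⌋₊))
    ((hu n).bdd ⌊(r + s) / h n⌋₊) hgR
  rw [areaDist_comm] at t2
  linarith

/-- Compactness of the approximate flows, uniformly on the torus and at every time. -/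
theorem exists_subseq_tendsto_graphFlow {P : Set (Cyl d) → ℝ≥0∞} (hP : IsGeneralizedPerimeter P)
    {L R : ℝ} (hL : 0 < L) {h : ℕ → ℝ} (hh : ∀ n, 0 < h n) (hh0 : Tendsto h atTop (𝓝 0))
    {u : ℕ → ℕ → Torus d → ℝ} (hu : ∀ n, IsGraphFlow P L R (h n) (u n)) {p : ℝ≥0∞}
    (hup : ∀ n, P (under (u n 0)) = p) :
    ∃ φ : ℕ → ℕ, StrictMono φ ∧ ∃ F : ℝ → C(Torus d, ℝ), ∃ ε : ℝ → ℕ → ℝ, ∀ t, 0 ≤ t →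
      F t ∈ lipClass d L R ∧ Tendsto (ε t) atTop (𝓝 0) ∧
      ∀ k x, |u (φ k) ⌊t / h (φ k)⌋₊ x - F t x| ≤ ε t k := by
  set f : ℕ → ℝ → C(Torus d, ℝ) := fun n t =>
    ⟨u n ⌊t / h n⌋₊, ((hu n).lip _).continuous⟩ with hf
  obtain ⟨φ, hφ, F, hF⟩ := exists_subseq_tendsto_curve (isCompact_lipClass d L R) (f := f)
    (fun n t => ⟨(hu n).lip _, (hu n).bdd _⟩) fun ε hε => by
      -- The Hölder estimate holds in measure; this upgrades it to the sup norm.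
      obtain ⟨η, hη, hclose⟩ := exists_abs_sub_le_of_areaDist_lt d hL.le R hε
      have hcont : Tendsto (fun τ : ℝ => √(8 * (1 + L) * p.toReal) * √τ) (𝓝 0) (𝓝 0) := by
        have : Continuous fun τ : ℝ => √(8 * (1 + L) * p.toReal) * √τ := by fun_prop
        simpa using this.tendsto 0
      obtain ⟨δ, hδ, hball⟩ := Metric.eventually_nhds_iff.1 (hcont.eventually (gt_mem_nhds hη))
      refine ⟨δ / 2, by positivity, ?_⟩
      filter_upwards [hh0.eventually (gt_mem_nhds (half_pos hδ))] with n hn s t hs ht hst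
      rw [ContinuousMap.dist_le hε.le]
      refine fun x => hclose _ _ ((hu n).lip _) ((hu n).lip _) ((hu n).bdd _) ((hu n).bdd _) ?_ x
      have h1 := (hu n).areaDist_floor_le hP hL (hh n) hs ht
      rw [hup n] at h1
      refine h1.trans_lt (hball ?_)
      rw [Real.dist_eq, sub_zero, abs_of_nonneg (add_nonneg (abs_nonneg _) (hh n).le)]
      linarith
  refine ⟨φ, hφ, F, fun t k => dist (f (φ k) t) (F t), fun t ht => ⟨(hF t ht).1, ?_, ?_⟩⟩
  · exact tendsto_iff_dist_tendsto_zero.1 (hF t ht).2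
  · exact fun k x => ContinuousMap.dist_apply_le_dist (f := f (φ k) t) (g := F t) x

end FlatFlow

/-! ### The flat flow and its properties -/

theorem theorem3p1 (d : ℕ) (hd : 2 ≤ d) (P : Set (FlatFlow.Cyl d) → ℝ≥0∞)
    (hP : FlatFlow.IsGeneralizedPerimeter P) (L : ℝ) (hL : 0 < L) (E₀ : Set (FlatFlow.Cyl d))
    (hE₀ : FlatFlow.IsLipSubgraph L E₀) (hfin : P E₀ < ∞) :
    ∃ C : ℝ, ∀ R : ℝ, 0 < R → FlatFlow.IsBetween R E₀ →
      ∀ h : ℕ → ℝ, (∀ n, 0 < h n) → Antitone h → Tendsto h atTop (𝓝 0) →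
        ∃ φ : ℕ → ℕ, StrictMono φ ∧ ∃ E : ℝ → Set (FlatFlow.Cyl d),
          -- convergence of the approximate flat solutions at every time
          FlatFlow.IsFlatFlow P R L (fun k => h (φ k)) E₀ E ∧
          -- Hölder continuity in time
          (∀ s t : ℝ, 0 ≤ s → 0 ≤ t →
            volume (E t ∆ E s) ≤ ENNReal.ofReal (C * |t - s| ^ (1 / 2 : ℝ))) ∧
          -- semigroup property: the flat flow restarted from `E r`, along the same time steps,
          -- exists and is the flow `E` shifted in time
          (∀ r : ℝ, 0 ≤ r →
            FlatFlow.IsFlatFlow P R L (fun k => h (φ k)) (E r) (fun s => E (r + s)) ∧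
            ∀ F : ℝ → Set (FlatFlow.Cyl d),
              FlatFlow.IsFlatFlow P R L (fun k => h (φ k)) (E r) F →
                ∀ s : ℝ, 0 ≤ s → F s = E (r + s)) ∧
          -- the perimeter decreases along the flow
          (∀ t t' : ℝ, 0 ≤ t → t ≤ t' → P (E t') ≤ P (E t)) := by
  open FlatFlow in
  obtain ⟨g₀, hg₀, rfl⟩ := hE₀
  change P (hypo g₀) < ∞ at hfin
  have hg₀' : TorusLip L g₀ := hg₀
  refine ⟨√(8 * (1 + L) * (P (hypo g₀)).toReal), fun R hR hbet h hh _ hh0 => ?_⟩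
  have hg₀R : ∀ x, |g₀ x| ≤ R := fun x => abs_le.2
    ⟨le_of_forall_lt fun c hc => by
        by_contra hlt
        obtain ⟨b, hb1, hb2⟩ := exists_between hc
        have : b ≤ g₀ x := hbet.2.1 (show ((x, b) : Cyl d).2 < -R from hb2)
        linarith,
      le_of_lt (hbet.2.2 (show ((x, g₀ x) : Cyl d) ∈ _ from le_refl (g₀ x)))⟩
  choose u hu hu0 hflow using fun n => exists_isGraphFlow hP hL hR (hh n) hg₀' hg₀R
  have hPg₀ : P (under g₀) = P (hypo g₀) := (hP.congr_ae (nullMeasurableSet_hypo hg₀'.continuous)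
    (nullMeasurableSet_under hg₀'.continuous) (hypo_ae_eq_under hg₀'.continuous)).symm
  have hup : ∀ n, P (under (u n 0)) = P (hypo g₀) := fun n => by rw [hu0, hPg₀]
  obtain ⟨φ, hφ, F, ε, hF⟩ := exists_subseq_tendsto_graphFlow hP hL hh hh0 hu hup
  have hhφ : Tendsto (fun k => h (φ k)) atTop (𝓝 0) := hh0.comp hφ.tendsto_atTop
  have hlip : ∀ t, 0 ≤ t → TorusLip L (F t) := fun t ht => (hF t ht).1.1
  have hbdd : ∀ t, 0 ≤ t → ∀ x, |F t x| ≤ R := fun t ht => (hF t ht).1.2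
  have hF0 : ⇑(F 0) = g₀ := by
    funext x
    have h1 : ∀ k, |g₀ x - F 0 x| ≤ ε 0 k := fun k => by
      have := (hF 0 le_rfl).2.2 k x
      rwa [zero_div, Nat.floor_zero, hu0] at this
    have h2 := ge_of_tendsto' (hF 0 le_rfl).2.1 h1
    have := abs_eq_zero.1 (le_antisymm h2 (abs_nonneg _))
    linarith
  -- Restarting from the limit at time `r` serves three purposes: `r = 0` is the convergence of the
  -- flow itself, general `r` is the semigroup property, and the perimeter bound gives monotonicity.
  have hrestart : ∀ r, 0 ≤ r → ∀ s, 0 ≤ s →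
      Tendsto (fun k => volume (approxFlow P R (h (φ k)) (hypo (F r)) s ∆ hypo (F (r + s))))
        atTop (𝓝 0) ∧
      ∀ k, NullMeasurableSet (approxFlow P R (h (φ k)) (hypo (F r)) s) volume ∧
        P (approxFlow P R (h (φ k)) (hypo (F r)) s) ≤ P (hypo (F r)) := by
    intro r hr s hs
    have hrs := add_nonneg hr hs
    choose v hv hv0 hvflow using fun k =>
      exists_isGraphFlow hP hL hR (hh (φ k)) (hlip r hr) (hbdd r hr)
    have hnull : ∀ k, NullMeasurableSet (approxFlow P R (h (φ k)) (hypo (F r)) s) volume :=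
      fun k => (nullMeasurableSet_under ((hv k).lip _).continuous).congr (hvflow k _).symm
    refine ⟨?_, fun k => ⟨hnull k, ?_⟩⟩
    · have key := tendsto_approxFlow_restart hP hL (fun k => hh (φ k)) hhφ
        (fun k => hu (φ k)) hv (fun k => hup (φ k)) hr hs (hF r hr).2.1 (hF _ hrs).2.1
        (hbdd _ hrs) (fun k x => by rw [hv0, abs_sub_comm]; exact (hF r hr).2.2 k x)
        (hF _ hrs).2.2
      have key' := ENNReal.tendsto_ofReal key
      rw [ENNReal.ofReal_zero] at key'
      refine key'.congr fun k => ?_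
      exact (volume_symmDiff_eq_ofReal ((hv k).bdd _) (hbdd _ hrs) (hvflow k _)
        (hypo_ae_eq_under (hlip _ hrs).continuous)).symm
    · have e1 := hP.congr_ae (hnull k) (nullMeasurableSet_under ((hv k).lip _).continuous)
        (hvflow k _)
      have e2 := hP.congr_ae (nullMeasurableSet_hypo (hlip r hr).continuous)
        (nullMeasurableSet_under (hlip r hr).continuous)
        (hypo_ae_eq_under (hlip r hr).continuous)
      rw [e1, e2, ← hv0 k]
      exact (hv k).antitone_perimeter hP hL (hh (φ k)) (Nat.zero_le _)
  have hsemi : ∀ r, 0 ≤ r → IsFlatFlow P R L (fun k => h (φ k)) (hypo (F r))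
      fun s => hypo (F (r + s)) := fun r hr =>
    ⟨by simp, fun s hs => ⟨⟨F (r + s), hlip _ (add_nonneg hr hs), rfl⟩, (hrestart r hr s hs).1⟩⟩
  refine ⟨φ, hφ, fun t => hypo (F t), ?_, ?_, fun r hr => ⟨hsemi r hr, ?_⟩, ?_⟩
  · have := hsemi 0 le_rfl
    simp only [hF0, zero_add] at this
    exact this
  · intro s t hs ht
    rw [volume_symmDiff_eq_ofReal (hbdd t ht) (hbdd s hs)
      (hypo_ae_eq_under (hlip t ht).continuous) (hypo_ae_eq_under (hlip s hs).continuous)]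
    refine ENNReal.ofReal_le_ofReal ?_
    rw [← Real.sqrt_eq_rpow]
    have hlim : Tendsto (fun k => 2 * ε t k + √(8 * (1 + L) * (P (hypo g₀)).toReal) *
        √(|t - s| + h (φ k)) + 2 * ε s k) atTop
        (𝓝 (2 * 0 + √(8 * (1 + L) * (P (hypo g₀)).toReal) * √(|t - s| + 0) + 2 * 0)) :=
      (((hF t ht).2.1.const_mul 2).add (((Real.continuous_sqrt.tendsto _).comp
        (hhφ.const_add _)).const_mul _)).add ((hF s hs).2.1.const_mul 2)
    simp only [mul_zero, add_zero, zero_add] at hlim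
    refine ge_of_tendsto' hlim fun k => ?_
    have hk := hu (φ k)
    have t1 := areaDist_le (hk.lip _).continuous ((hF t ht).2.2 k)
    have t2 := hk.areaDist_floor_le hP hL (hh (φ k)) hs ht
    have t3 := areaDist_le (hk.lip _).continuous ((hF s hs).2.2 k)
    rw [hup] at t2
    rw [areaDist_comm] at t1
    have q1 := areaDist_triangle (hbdd t ht) (hk.bdd ⌊t / h (φ k)⌋₊) (hbdd s hs)
    have q2 := areaDist_triangle (hk.bdd ⌊t / h (φ k)⌋₊) (hk.bdd ⌊s / h (φ k)⌋₊) (hbdd s hs)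
    linarith
  · intro G hG s hs
    obtain ⟨⟨g, hg, hgG⟩, hGlim⟩ := hG.2 s hs
    have hg' : TorusLip L g := hg
    have hrs := add_nonneg hr hs
    -- Both limits agree up to a null set; closed subgraphs of continuous functions that do so are
    -- equal.
    have h0 := eq_zero_of_tendsto_symmDiff hGlim (hrestart r hr s hs).1
    have hae : hypo g =ᵐ[volume] hypo (F (r + s)) := by
      rw [hgG] at h0
      exact measure_symmDiff_eq_zero_iff.1 h0
    rw [hgG]
    change hypo g = hypo (F (r + s))
    rw [eq_of_hypo_ae_eq hg'.continuous (hlip _ hrs).continuous hae]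
  · intro t t' ht htt'
    -- Perimeters of the original approximations at time `t` need not converge to that of the limit.
    -- Those restarted from the limit at `t` begin with exactly its perimeter and never exceed it.
    obtain ⟨hlim, hA⟩ := hrestart t ht (t' - t) (sub_nonneg.2 htt')
    rw [add_sub_cancel] at hlim
    have hlsc := hP.lsc (hypo (F t')) (fun k => approxFlow P R (h (φ k)) (hypo (F t)) (t' - t))
      (nullMeasurableSet_hypo (hlip t' (ht.trans htt')).continuous) (fun k => (hA k).1)
      fun r _ => tendsto_of_tendsto_of_tendsto_of_le_of_le tendsto_const_nhds hlim
        (fun _ => zero_le) fun k => measure_mono Set.inter_subset_left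
    refine hlsc.trans ?_
    refine (liminf_le_liminf (Eventually.of_forall fun k => (hA k).2)).trans ?_
    simp
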